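/- Let $d\in\{1,2\}$ and, for $k\in\mathbb Z^d$, let $|k|$ be the Euclidean norm. Let $\mu_2=\bigotimes_{k\in\mathbb Z^d\setminus\{0\}}\mu_2^k$ be the Gaussian product measure on sequences $\varphi=(\varphi_k)_{k\in\mathbb Z^d\setminus\{0\}}$ of complex numbers, where $\mu_2^k$ has density $z\mapsto\frac{|k|^2}{2\pi}e^{-\frac12|k|^2|z|^2}$ with respect to Lebesgue measure on $\mathbb C$; put $\varphi_0=0$. For $\beta\in\mathbb R$ let $\|\varphi\|_{H^\beta}=\big(\sum_{k\ne0}|k|^{2\beta}|\varphi_k|^2\big)^{1/2}$, and for $p\ge1$ let $\|F\|_{L^p(\mu_2;H^\beta)}=\big(\int\|F(\varphi)\|_{H^\beta}^p\,d\mu_2(\varphi)\big)^{1/p}$. Let $B$ be the cubic field $$B_k(\varphi)=\sum_{l,m\in\mathbb Z^d}\varphi_{k-m}\,\varphi_{l+m}\,\overline{\varphi_l},\qquad k\ne0 .$$ (i) If $d=1$, then for $\mu_2$-almost every $\varphi$ the series defining $B_k(\varphi)$ converges absolutely for every $k\neq 0$, and $B\in L^p(\mu_2;H^\beta)$ for all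 $\beta<0$ and $p\ge1$. (ii) Let $d=2$. For $N\in\mathbb N$ let $\Pi_N$ be the projection on the frequencies $1\le|k|\le N$, and let $$(:B:)^N(\varphi)=\Pi_N B(\Pi_N\varphi)-4\Big(\sum_{1\le|m|\le N}\frac1{|m|^2}\Big)\Pi_N\varphi .$$ Then for all $\beta<0$ and $p\ge1$ we have $(:B:)^N\in L^p(\mu_2;H^\beta)$ with $\sup_N\|(:B:)^N\|_{L^p(\mu_2;H^\beta)}<\infty$. Moreover there is a field $:B:$, not depending on $\beta$ and $p$, such that for all $\beta<0$ and $p\ge1$ we have $:B:\in L^p(\mu_2;H^\beta)$ and $(:B:)^N\to\,:B:$ in $L^p(\mu_2;H^\beta)$ as $N\to\infty$. -/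

import Mathlib

open MeasureTheory Filter
open scoped ENNReal NNReal Topology ComplexConjugate

noncomputable section

namespace WickNLS

/-- Euclidean length of a frequency. -/
def len {d : ℕ} (k : Fin d → ℤ) : ℝ := √(∑ i, (k i : ℝ) ^ 2)

/-- Nonzero frequencies; the zero mode is excluded throughout. -/
abbrev Freq (d : ℕ) : Type := {k : Fin d → ℤ // k ≠ 0}

/-- Families of Fourier coefficients `(φ_k)`, `k ≠ 0`, i.e. mean-zero formal Fourier series. -/
abbrev Field (d : ℕ) : Type := Freq d → ℂ

theorem len_pos {d : ℕ} (k : Freq d) : 0 < len k.1 := by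
  obtain ⟨k, hk⟩ := k
  obtain ⟨i, hi⟩ := Function.ne_iff.mp hk
  have hi' : (k i : ℝ) ≠ 0 := by exact_mod_cast hi
  exact Real.sqrt_pos.mpr (Finset.sum_pos' (fun j _ => sq_nonneg _)
    ⟨i, Finset.mem_univ i, by positivity⟩)

/-- The law of the mode `φ_k`: density `|k|^a / (2π) * exp (-|k|^a |z|² / 2)` on `ℂ`. -/
def modeLaw {d : ℕ} (a : ℝ) (k : Freq d) : Measure ℂ :=
  volume.withDensity fun z : ℂ =>
    ENNReal.ofReal (len k.1 ^ a / (2 * Real.pi) * Real.exp (-(len k.1 ^ a / 2) * ‖z‖ ^ 2))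

instance {d : ℕ} (a : ℝ) (k : Freq d) : IsProbabilityMeasure (modeLaw a k) := by
  have hc : 0 < len k.1 ^ a := Real.rpow_pos_of_pos (len_pos k) a
  have hI := GaussianFourier.integral_rexp_neg_mul_sq_norm (V := ℂ) (half_pos hc)
  have h1 : ∫ z : ℂ, len k.1 ^ a / (2 * Real.pi) *
      Real.exp (-(len k.1 ^ a / 2) * ‖z‖ ^ 2) = 1 := by
    rw [integral_const_mul, hI, Complex.finrank_real_complex]
    have := Real.pi_pos
    norm_num
    field_simp
  refine ⟨?_⟩
  rw [modeLaw, withDensity_apply _ MeasurableSet.univ, Measure.restrict_univ,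
    ← ofReal_integral_eq_lintegral_ofReal, h1, ENNReal.ofReal_one]
  · by_contra h
    rw [integral_undef h] at h1
    exact zero_ne_one h1
  · exact Eventually.of_forall fun z => by have := Real.pi_pos; positivity

/-- The Gaussian measure `μ_a`: the modes `φ_k` are independent with law `modeLaw a k`. -/
def mu (d : ℕ) (a : ℝ) : Measure (Field d) :=
  Measure.infinitePi fun k : Freq d => modeLaw a k

/-- The coefficient at an arbitrary frequency, the zero mode being `0`. -/
def coef {d : ℕ} (φ : Field d) (n : Fin d → ℤ) : ℂ := if h : n ≠ 0 then φ ⟨n, h⟩ else 0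

/-- The summand `φ_{k-m} φ_{l+m} conj φ_l`, indexed by `q = (l, m)`. -/
def cubicTerm {d : ℕ} (φ : Field d) (k : Freq d) (q : (Fin d → ℤ) × (Fin d → ℤ)) : ℂ :=
  coef φ (k.1 - q.2) * coef φ (q.1 + q.2) * conj (coef φ q.1)

/-- The cubic field `B_k(φ) = ∑_{l,m} φ_{k-m} φ_{l+m} conj φ_l`. -/
def cubicField {d : ℕ} (φ : Field d) : Field d := fun k => ∑' q, cubicTerm φ k q

/-- Projection on the frequencies `1 ≤ |k| ≤ N`. -/
def proj {d : ℕ} (N : ℕ) (φ : Field d) : Field d := fun k => if len k.1 ≤ N then φ k else 0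

/-- `∑_{1 ≤ |m| ≤ N} |m|^{-a}`; all such `m` lie in the cube `[-N, N]^d`. -/
def wickSum (d : ℕ) (a : ℝ) (N : ℕ) : ℝ :=
  ∑ m ∈ (Fintype.piFinset fun _ : Fin d => Finset.Icc (-(N : ℤ)) N) with
    1 ≤ len m ∧ len m ≤ N, 1 / len m ^ a

/-- The truncated Wick-renormalised field
`Π_N B(Π_N φ) - 4 (∑_{1 ≤ |m| ≤ N} |m|^{-a}) Π_N φ`. -/
def wickField {d : ℕ} (a : ℝ) (N : ℕ) (φ : Field d) : Field d := fun k =>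
  proj N (cubicField (proj N φ)) k - 4 * (wickSum d a N : ℂ) * proj N φ k

/-- The `H^β` norm `(∑_{k ≠ 0} |k|^{2β} |φ_k|²)^{1/2}`, equal to `∞` off `H^β`. -/
def sobolevNorm {d : ℕ} (β : ℝ) (φ : Field d) : ℝ≥0∞ :=
  (∑' k : Freq d, ENNReal.ofReal (len k.1 ^ (2 * β)) * ‖φ k‖ₑ ^ 2) ^ (1 / 2 : ℝ)

/-- The norm of `F` in `L^p(μ; H^β)`. -/
def lpSobolevNorm {d : ℕ} (μ : Measure (Field d)) (β p : ℝ) (F : Field d → Field d) : ℝ≥0∞ :=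
  (∫⁻ φ, sobolevNorm β (F φ) ^ p ∂μ) ^ (1 / p)

/-- `F ∈ L^p(μ; H^β)`. -/
def MemLpSobolev {d : ℕ} (μ : Measure (Field d)) (β p : ℝ) (F : Field d → Field d) : Prop :=
  (∀ k, AEMeasurable (fun φ => F φ k) μ) ∧ lpSobolevNorm μ β p F < ∞

end WickNLS

end

noncomputable section

namespace WickNLS

variable {d : ℕ}

/-! Both dimensions rest on one lattice sum. Since $(k-m)+(l+m)-l=k$, any three of the frequencies
$k,\ k-m,\ l+m,\ l$ determine the fourth. Raising the largest of them to power zero and sharing its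
decay among the others (`quad_rpow_bound`) bounds
$\sum_k|k|^{-\sigma}\sum_{l,m}|k-m|^{-d}|l+m|^{-d}|l|^{-d}$ by cubes of the convergent sum
$\sum_n|n|^{-d-\sigma/3}$ (`tsum_resonant_ne_top`). The amplitude of $\varphi_n$ is $|n|^{-1}$, so
for $d=1$ this is a sum of amplitudes and for $d=2$ a sum of squared amplitudes.

For $d=1$ no cancellation is needed: the triangle inequality in $L^n$ controls the series term by
term.

For $d=2$ square summability suffices once the terms are orthogonal. The counterterm removes exactly
the two contractions of $\bar\varphi_l$, with $\varphi_{l+m}$ when $m=0$ and with $\varphi_{k-m}$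
when $k-m=l$. Each contributes $2\sum|n|^{-2}\varphi_k$, because $E|\varphi_n|^2=2|n|^{-2}$. What
remains is a sum of products of centred Hermite polynomials in independent modes
(`wickField_eq_sum`, `prod_herm`).

Higher moments come from `chaos_moment_le`, which plays the role of hypercontractivity. Independent
variables are added one at a time, and each increment is a martingale difference, to which a uniform
smoothness inequality for $L^{2(q+1)}$ applies. Applied to the difference of two truncations, the
bound is governed by a tail of the lattice sum. Hence each mode is Cauchy in $L^2$; the limit is
built mode by mode, so it depends on neither $\beta$ nor $p$, and Fatou's lemma carries every moment
bound over to it. -/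

theorem one_le_len (k : Freq d) : 1 ≤ len k.1 := by
  obtain ⟨k, hk⟩ := k
  obtain ⟨i, hi⟩ := Function.ne_iff.mp hk
  have h1 : (1 : ℝ) ≤ (k i : ℝ) ^ 2 := by
    have : (1 : ℤ) ≤ (k i) ^ 2 := Int.one_le_abs (pow_ne_zero 2 hi) |>.trans (by simp)
    exact_mod_cast this
  exact Real.one_le_sqrt.mpr (h1.trans
    (Finset.single_le_sum (f := fun i => (k i : ℝ) ^ 2) (fun j _ => sq_nonneg _)
      (Finset.mem_univ i)))

/-! ### Lattice sums over resonant frequencies. -/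

theorem summable_len_rpow {s : ℝ} (hs : (d : ℝ) < s) :
    Summable fun n : Fin d → ℤ => len n ^ (-s) := by
  -- The sum is identified with $\sum\|x\|^{-s}$ over the standard lattice in Euclidean space, whose
  -- rank is $d$.
  let b := (EuclideanSpace.basisFun (Fin d) ℝ).toBasis
  let L := Submodule.span ℤ (Set.range b)
  have hL : Module.finrank ℤ L = d := by
    rw [ZLattice.rank ℝ L]; simp
  have h := ZLattice.summable_norm_rpow L (-s) (by rw [hL]; linarith)
  let g : (Fin d → ℤ) → L := fun n => ⟨∑ i, n i • b i,
    Submodule.sum_mem _ fun i _ => Submodule.smul_mem _ _ (Submodule.subset_span ⟨i, rfl⟩)⟩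
  have hg : ∀ n i, ((g n : EuclideanSpace ℝ (Fin d)) i) = n i := by
    intro n i
    simp [g, b, Finset.sum_apply, Pi.single_apply]
  have hinj : Function.Injective g := by
    intro n m h
    funext i
    have := hg n i
    rw [h, hg m i] at this
    exact Int.cast_injective this.symm
  refine (h.comp_injective hinj).congr fun n => ?_
  have : ‖g n‖ = len n := by
    rw [Submodule.coe_norm, EuclideanSpace.norm_eq, len]
    simp [hg]
  simp only [Function.comp_apply, this]

/-- The weight `|n|^{-s}` on nonzero frequencies, extended by `0` to the zero frequency. -/
def wt (s : ℝ) (n : Fin d → ℤ) : ℝ≥0∞ := if n = 0 then 0 else ENNReal.ofReal (len n ^ (-s))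

theorem wt_coe (s : ℝ) (k : Freq d) : wt s k.1 = ENNReal.ofReal (len k.1 ^ (-s)) := by
  simp [wt, k.2]

theorem tsum_wt_ne_top {s : ℝ} (hs : (d : ℝ) < s) : ∑' n : Fin d → ℤ, wt s n ≠ ∞ := by
  refine ne_top_of_le_ne_top (summable_len_rpow hs).tsum_ofReal_ne_top
    (ENNReal.tsum_le_tsum fun n => ?_)
  unfold wt; split_ifs <;> simp

/-- In logarithms everything is linear, and each summand on the right omits one of the four numbers;
the one omitting the largest already suffices. If $E$ is largest, $E^{-\sigma}$ is split into three
factors of exponent $-\sigma/3$. If $A$ is largest, its exponent $D$ is spent as $\sigma/3+\sigma/3$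
on $B$ and $C$ and $D-2\sigma/3$ on $E$, the last being nonnegative because $\sigma\le D$. -/
theorem quad_rpow_bound {A B C E D σ : ℝ} (hA : 1 ≤ A) (hB : 1 ≤ B) (hC : 1 ≤ C) (hE : 1 ≤ E)
    (hσ : 0 < σ) (hD : σ ≤ D) :
    E ^ (-σ) * (A ^ (-D) * B ^ (-D) * C ^ (-D)) ≤
      A ^ (-(D + σ / 3)) * B ^ (-(D + σ / 3)) * C ^ (-(D + σ / 3)) +
      B ^ (-(D + σ / 3)) * C ^ (-(D + σ / 3)) * E ^ (-(D + σ / 3)) +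
      A ^ (-(D + σ / 3)) * C ^ (-(D + σ / 3)) * E ^ (-(D + σ / 3)) +
      A ^ (-(D + σ / 3)) * B ^ (-(D + σ / 3)) * E ^ (-(D + σ / 3)) := by
  have hexp : ∀ X : ℝ, 1 ≤ X → ∀ t : ℝ, X ^ t = Real.exp (Real.log X * t) :=
    fun X hX t => Real.rpow_def_of_pos (by linarith) t
  simp only [hexp A hA, hexp B hB, hexp C hC, hexp E hE, ← Real.exp_add]
  have key : ∀ a b c e : ℝ, a ≤ e → b ≤ e → c ≤ e →
      e * -σ + (a * -D + b * -D + c * -D) ≤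
        a * -(D + σ / 3) + b * -(D + σ / 3) + c * -(D + σ / 3) := by
    intro a b c e h1 h2 h3
    nlinarith
  have key' : ∀ a b c e : ℝ, b ≤ a → c ≤ a → e ≤ a →
      e * -σ + (a * -D + b * -D + c * -D) ≤
        b * -(D + σ / 3) + c * -(D + σ / 3) + e * -(D + σ / 3) := by
    intro a b c e h1 h2 h3
    nlinarith
  generalize Real.log A = a
  generalize Real.log B = b
  generalize Real.log C = c
  generalize Real.log E = e
  have p1 := Real.exp_pos (a * -(D + σ / 3) + b * -(D + σ / 3) + c * -(D + σ / 3))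
  have p2 := Real.exp_pos (b * -(D + σ / 3) + c * -(D + σ / 3) + e * -(D + σ / 3))
  have p3 := Real.exp_pos (a * -(D + σ / 3) + c * -(D + σ / 3) + e * -(D + σ / 3))
  have p4 := Real.exp_pos (a * -(D + σ / 3) + b * -(D + σ / 3) + e * -(D + σ / 3))
  by_cases hmax : a ≤ e ∧ b ≤ e ∧ c ≤ e
  · linarith [Real.exp_le_exp.mpr (key a b c e hmax.1 hmax.2.1 hmax.2.2)]
  by_cases ha : b ≤ a ∧ c ≤ a ∧ e ≤ a
  · linarith [Real.exp_le_exp.mpr (key' a b c e ha.1 ha.2.1 ha.2.2)]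
  by_cases hb : a ≤ b ∧ c ≤ b ∧ e ≤ b
  · have := key' b a c e hb.1 hb.2.1 hb.2.2
    rw [add_comm (b * -D)] at this
    linarith [Real.exp_le_exp.mpr this]
  · have hc : a ≤ c ∧ b ≤ c ∧ e ≤ c := by grind
    have := key' c a b e hc.1 hc.2.1 hc.2.2
    rw [show c * -D + a * -D + b * -D = a * -D + b * -D + c * -D by ring] at this
    linarith [Real.exp_le_exp.mpr this]

/-- `|n₁|^{-s} |n₂|^{-s} |n₃|^{-s}` as a function of three frequencies. -/
def wt₃ (s : ℝ) (x : (Fin d → ℤ) × (Fin d → ℤ) × (Fin d → ℤ)) : ℝ≥0∞ :=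
  wt s x.1 * wt s x.2.1 * wt s x.2.2

theorem tsum_wt₃_ne_top {s : ℝ} (hs : (d : ℝ) < s) : ∑' x, wt₃ (d := d) s x ≠ ∞ := by
  have h : ∑' x, wt₃ (d := d) s x = (∑' n : Fin d → ℤ, wt s n) ^ 3 := by
    rw [ENNReal.tsum_prod']
    simp only [wt₃, ENNReal.tsum_prod', mul_assoc, ENNReal.tsum_mul_left, ENNReal.tsum_mul_right]
    ring
  rw [h]
  exact ENNReal.pow_ne_top (tsum_wt_ne_top hs)

theorem wt_quad_le {D σ : ℝ} (hσ : 0 < σ) (hD : σ ≤ D) (n₁ n₂ n₃ k : Fin d → ℤ) :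
    wt σ k * (wt D n₁ * wt D n₂ * wt D n₃) ≤
      wt₃ (D + σ / 3) (n₁, n₂, n₃) + wt₃ (D + σ / 3) (n₂, n₃, k) +
      wt₃ (D + σ / 3) (n₁, n₃, k) + wt₃ (D + σ / 3) (n₁, n₂, k) := by
  by_cases h0 : k = 0 ∨ n₁ = 0 ∨ n₂ = 0 ∨ n₃ = 0
  · rcases h0 with h | h | h | h <;> simp [wt, h]
  push Not at h0
  obtain ⟨hk, h1, h2, h3⟩ := h0
  have H := quad_rpow_bound (one_le_len ⟨n₁, h1⟩) (one_le_len ⟨n₂, h2⟩) (one_le_len ⟨n₃, h3⟩)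
    (one_le_len ⟨k, hk⟩) hσ hD
  have h₁ := (len_pos ⟨n₁, h1⟩).le
  have h₂ := (len_pos ⟨n₂, h2⟩).le
  have h₃ := (len_pos ⟨n₃, h3⟩).le
  have h₄ := (len_pos ⟨k, hk⟩).le
  simp only at H h₁ h₂ h₃ h₄
  simp only [wt₃, wt, if_neg hk, if_neg h1, if_neg h2, if_neg h3]
  refine le_of_eq_of_le ?_ ((ENNReal.ofReal_le_ofReal H).trans_eq ?_)
  · rw [ENNReal.ofReal_mul (by positivity), ENNReal.ofReal_mul (by positivity),
      ENNReal.ofReal_mul (by positivity)]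
  · rw [ENNReal.ofReal_add (by positivity) (by positivity),
      ENNReal.ofReal_add (by positivity) (by positivity),
      ENNReal.ofReal_add (by positivity) (by positivity)]
    congr 1
    · congr 1
      · congr 1 <;> rw [ENNReal.ofReal_mul (by positivity), ENNReal.ofReal_mul (by positivity)]
      · rw [ENNReal.ofReal_mul (by positivity), ENNReal.ofReal_mul (by positivity)]
    · rw [ENNReal.ofReal_mul (by positivity), ENNReal.ofReal_mul (by positivity)]

/-- The weighted sum over all `k` and all resonant triples is finite. -/
theorem tsum_resonant_ne_top {σ : ℝ} (hσ : 0 < σ) (hd : σ ≤ d) :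
    ∑' x : (Fin d → ℤ) × (Fin d → ℤ) × (Fin d → ℤ),
      wt σ x.1 * (wt d (x.1 - x.2.2) * wt d (x.2.1 + x.2.2) * wt d x.2.1) ≠ ∞ := by
  have hs : (d : ℝ) < d + σ / 3 := by linarith
  have hfin := tsum_wt₃_ne_top (d := d) hs
  have hcomp : ∀ g : (Fin d → ℤ) × (Fin d → ℤ) × (Fin d → ℤ) →
      (Fin d → ℤ) × (Fin d → ℤ) × (Fin d → ℤ), Function.Injective g →
      ∑' x, wt₃ (d + σ / 3) (g x) ≠ ∞ := fun g hg =>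
    ne_top_of_le_ne_top hfin (ENNReal.tsum_comp_le_tsum_of_injective hg _)
  refine ne_top_of_le_ne_top ?_ (ENNReal.tsum_le_tsum fun x => wt_quad_le hσ hd _ _ _ _)
  rw [ENNReal.tsum_add, ENNReal.tsum_add, ENNReal.tsum_add]
  -- Each of the four sums runs over three of the four frequencies, and that triple is an injective
  -- function of $(k,l,m)$.
  refine ENNReal.add_ne_top.mpr ⟨ENNReal.add_ne_top.mpr ⟨ENNReal.add_ne_top.mpr
    ⟨hcomp (fun x => (x.1 - x.2.2, x.2.1 + x.2.2, x.2.1)) ?_,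
      hcomp (fun x => (x.2.1 + x.2.2, x.2.1, x.1)) ?_⟩,
      hcomp (fun x => (x.1 - x.2.2, x.2.1, x.1)) ?_⟩,
      hcomp (fun x => (x.1 - x.2.2, x.2.1 + x.2.2, x.1)) ?_⟩ <;>
  · rintro ⟨k, l, m⟩ ⟨k', l', m'⟩ h
    simp only [Prod.mk.injEq] at h ⊢
    grind

/-! ### Minkowski's inequality and reduction to moments of single modes. -/

section Minkowski

variable {Ω ι : Type*} [MeasurableSpace Ω] {μ : Measure Ω}

theorem lintegral_finset_sum_rpow_le (s : Finset ι) {f : ι → Ω → ℝ≥0∞}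
    (hf : ∀ i, AEMeasurable (f i) μ) {q : ℝ} (hq : 1 ≤ q) :
    (∫⁻ ω, (∑ i ∈ s, f i ω) ^ q ∂μ) ^ (1 / q) ≤ ∑ i ∈ s, (∫⁻ ω, f i ω ^ q ∂μ) ^ (1 / q) := by
  classical
  induction s using Finset.induction_on with
  | empty => simp [show 0 < q by linarith]
  | insert i s hi ih =>
    simp only [Finset.sum_insert hi]
    refine le_trans ?_ (add_le_add le_rfl ih)
    exact ENNReal.lintegral_Lp_add_le (hf i) (Finset.aemeasurable_fun_sum s fun i _ => hf i) hq

/-- Minkowski's inequality for countable sums of nonnegative functions. -/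
theorem lintegral_tsum_rpow_le [Countable ι] {f : ι → Ω → ℝ≥0∞}
    (hf : ∀ i, AEMeasurable (f i) μ) {q : ℝ} (hq : 1 ≤ q) :
    (∫⁻ ω, (∑' i, f i ω) ^ q ∂μ) ^ (1 / q) ≤ ∑' i, (∫⁻ ω, f i ω ^ q ∂μ) ^ (1 / q) := by
  have hq0 : 0 < q := by linarith
  have hsup : ∀ ω, (∑' i, f i ω) ^ q = ⨆ s : Finset ι, (∑ i ∈ s, f i ω) ^ q := by
    intro ω
    rw [ENNReal.tsum_eq_iSup_sum]
    exact (ENNReal.orderIsoRpow q hq0).map_iSup _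
  have hdir : Directed (· ≤ ·) fun (s : Finset ι) (ω : Ω) => (∑ i ∈ s, f i ω) ^ q :=
    directed_of_isDirected_le fun s t hst ω =>
      ENNReal.rpow_le_rpow (Finset.sum_le_sum_of_subset hst) hq0.le
  simp only [hsup]
  rw [lintegral_iSup_directed
    (fun s => (Finset.aemeasurable_fun_sum s fun i _ => hf i).pow_const q) hdir, one_div,
    ENNReal.rpow_inv_le_iff hq0]
  refine iSup_le fun s => ?_
  rw [← ENNReal.rpow_inv_le_iff hq0, ← one_div]
  exact (lintegral_finset_sum_rpow_le s hf hq).trans (ENNReal.sum_le_tsum s)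

end Minkowski

/-- The squared Sobolev norm is a sum over modes, so Minkowski in $L^q$ applies to it after $p$ has
been raised to the even exponent $2q$. Only even integer moments of individual modes are needed
afterwards. -/
theorem lpSobolevNorm_le {μ : Measure (Field d)} [IsProbabilityMeasure μ] {β p : ℝ} (hp : 1 ≤ p)
    {q : ℕ} (hpq : p ≤ 2 * q) {F : Field d → Field d} (hF : ∀ k, AEMeasurable (fun φ => F φ k) μ) :
    lpSobolevNorm μ β p F ≤ (∑' k : Freq d, ENNReal.ofReal (len k.1 ^ (2 * β)) *
      (∫⁻ φ, ‖F φ k‖ₑ ^ (2 * q) ∂μ) ^ (1 / (q : ℝ))) ^ (1 / 2 : ℝ) := by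
  have hp0 : 0 < p := by linarith
  have hq1 : (1 : ℝ) ≤ q := by
    have : 0 < (q : ℝ) := by linarith
    exact_mod_cast Nat.one_le_iff_ne_zero.mpr (by rintro rfl; simp at this)
  have hq0 : (0 : ℝ) < q := by linarith
  set S : Field d → ℝ≥0∞ := fun φ =>
    ∑' k : Freq d, ENNReal.ofReal (len k.1 ^ (2 * β)) * ‖F φ k‖ₑ ^ 2 with hS
  have hm : ∀ k : Freq d, AEMeasurable
      (fun φ => ENNReal.ofReal (len k.1 ^ (2 * β)) * ‖F φ k‖ₑ ^ 2) μ :=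
    fun k => ((hF k).enorm.pow_const 2).const_mul _
  have hSm : AEMeasurable S μ := AEMeasurable.tsum hm
  have h1 : ∫⁻ φ, sobolevNorm β (F φ) ^ p ∂μ ≤ (∫⁻ φ, S φ ^ (q : ℝ) ∂μ) ^ (p / (2 * q)) := by
    -- Hölder against the constant $1$: on a probability space the $L^p$ norm is at most the
    -- $L^{2q}$ norm.
    have := ENNReal.lintegral_mul_norm_pow_le (μ := μ) (f := fun φ => S φ ^ (q : ℝ))
      (g := fun _ => 1) (hSm.pow_const _) aemeasurable_const (p := p / (2 * q))
      (q := 1 - p / (2 * q)) (by positivity)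
      (by rw [sub_nonneg, div_le_one (by positivity)]; exact hpq) (by ring)
    simp only [ENNReal.one_rpow, mul_one, lintegral_one, measure_univ] at this
    refine le_trans (le_of_eq (lintegral_congr fun φ => ?_)) this
    rw [sobolevNorm, ← ENNReal.rpow_mul, ← ENNReal.rpow_mul]
    congr 1
    field_simp
  have h2 := lintegral_tsum_rpow_le hm hq1
  calc lpSobolevNorm μ β p F
      ≤ ((∫⁻ φ, S φ ^ (q : ℝ) ∂μ) ^ (p / (2 * q))) ^ (1 / p) :=
        ENNReal.rpow_le_rpow h1 (by positivity)
    _ = ((∫⁻ φ, S φ ^ (q : ℝ) ∂μ) ^ (1 / (q : ℝ))) ^ (1 / 2 : ℝ) := by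
        rw [← ENNReal.rpow_mul, ← ENNReal.rpow_mul]
        congr 1
        field_simp
    _ ≤ _ := by
        refine ENNReal.rpow_le_rpow (h2.trans_eq (tsum_congr fun k => ?_)) (by positivity)
        have : ∀ φ, (ENNReal.ofReal (len k.1 ^ (2 * β)) * ‖F φ k‖ₑ ^ 2) ^ (q : ℝ) =
            ENNReal.ofReal (len k.1 ^ (2 * β)) ^ (q : ℝ) * ‖F φ k‖ₑ ^ (2 * q) := fun φ => by
          rw [ENNReal.mul_rpow_of_nonneg _ _ hq0.le, ENNReal.rpow_natCast (‖F φ k‖ₑ ^ 2), ← pow_mul]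
        simp only [this]
        rw [lintegral_const_mul'' _ ((hF k).enorm.pow_const _),
          ENNReal.mul_rpow_of_nonneg _ _ (by positivity), ← ENNReal.rpow_mul,
          mul_one_div_cancel hq0.ne', ENNReal.rpow_one]

/-! ### A second-order Taylor inequality for even powers of the modulus. -/

section Smoothness

/-- Meant for $x=|a|^2$, $u=|b|^2$ and $y=|a+b|^2-|a|^2$ with $|b|\le|a|$; the hypotheses on $y$ are
what that regime provides. -/
theorem add_pow_le_taylor (q : ℕ) : ∃ C : ℝ, 0 ≤ C ∧ ∀ x y u : ℝ, 0 ≤ x → 0 ≤ u → 0 ≤ x + y →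
    y ≤ 3 * x → y ^ 2 ≤ 9 * (x * u) →
    (x + y) ^ (q + 1) ≤ x ^ (q + 1) + (q + 1) * x ^ q * y + C * (x ^ q * u) := by
  induction q with
  | zero => exact ⟨0, le_rfl, fun x y u _ _ _ _ _ => by simp⟩
  | succ q ih =>
    obtain ⟨C, hC, h⟩ := ih
    -- Multiplying the previous bound by $x+y$ produces $(q+1)x^qy^2\le 9(q+1)x^{q+1}u$ and
    -- $Cx^qu(x+y)\le 4Cx^{q+1}u$.
    refine ⟨9 * (q + 1) + 4 * C, by positivity, fun x y u hx hu hxy hy hyu => ?_⟩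
    have h1 := mul_le_mul_of_nonneg_right (h x y u hx hu hxy hy hyu) hxy
    have h2 := mul_le_mul_of_nonneg_left hyu (show 0 ≤ (q + 1 : ℝ) * x ^ q by positivity)
    have h3 := mul_le_mul_of_nonneg_left hy (show 0 ≤ C * (x ^ q * u) by positivity)
    push_cast
    rw [pow_succ (x + y)]
    linear_combination h1 + h2 + h3

theorem norm_add_pow_le_taylor (q : ℕ) : ∃ C : ℝ, 1 ≤ C ∧ ∀ a b : ℂ,
    ‖a + b‖ ^ (2 * (q + 1)) ≤ ‖a‖ ^ (2 * (q + 1)) +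
      2 * (q + 1) * (‖a‖ ^ (2 * q) * (conj a * b).re) +
      C * (‖a‖ ^ (2 * q) * ‖b‖ ^ 2 + ‖b‖ ^ (2 * (q + 1))) := by
  obtain ⟨C, hC, h⟩ := add_pow_le_taylor q
  -- The term $q+1$ absorbs the $|b|^2$ inside $y$. The last two serve the case $|a|\le|b|$: one for
  -- $|a+b|\le 2|b|$, one for the cross term, which may be negative.
  refine ⟨C + (q + 1) + 4 ^ (q + 1) + 2 * (q + 1) , ?_, fun a b => ?_⟩
  · have : (0 : ℝ) ≤ q := by positivity
    have : (0 : ℝ) ≤ 4 ^ (q + 1) := by positivity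
    linarith
  have hre : |(conj a * b).re| ≤ ‖a‖ * ‖b‖ := by
    refine (Complex.abs_re_le_norm _).trans_eq ?_
    simp
  have hsq : ‖a + b‖ ^ 2 = ‖a‖ ^ 2 + (2 * (conj a * b).re + ‖b‖ ^ 2) := by
    rw [Complex.sq_norm, Complex.sq_norm, Complex.sq_norm, Complex.normSq_add]
    have : (a * conj b).re = (conj a * b).re := by simp
    rw [this]; ring
  generalize (conj a * b).re = r at *
  have hq : (0 : ℝ) ≤ q := by positivity
  rcases le_total ‖b‖ ‖a‖ with hba | hab
  · have hb := norm_nonneg b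
    obtain ⟨hr1, hr2⟩ := abs_le.mp hre
    have hbb : ‖b‖ ^ 2 ≤ ‖a‖ * ‖b‖ := by nlinarith
    have haa : ‖a‖ * ‖b‖ ≤ ‖a‖ ^ 2 := by nlinarith
    have hy : |2 * r + ‖b‖ ^ 2| ≤ 3 * (‖a‖ * ‖b‖) := by
      rw [abs_le]; constructor <;> nlinarith
    have := h (‖a‖ ^ 2) (2 * r + ‖b‖ ^ 2) (‖b‖ ^ 2) (by positivity) (by positivity)
      (by rw [← hsq]; positivity) (by linarith [le_of_abs_le hy]) (by
        have := pow_le_pow_left₀ (abs_nonneg _) hy 2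
        rw [sq_abs] at this
        refine this.trans_eq (by ring))
    rw [← hsq, ← pow_mul, ← pow_mul, ← pow_mul] at this
    refine this.trans ?_
    have e1 : 0 ≤ ‖a‖ ^ (2 * q) * ‖b‖ ^ 2 := by positivity
    have e2 : 0 ≤ ‖b‖ ^ (2 * (q + 1)) := by positivity
    have e3 : 0 ≤ (C + (q + 1) + 4 ^ (q + 1) + 2 * (q + 1)) * ‖b‖ ^ (2 * (q + 1)) := by positivity
    have e4 : 0 ≤ ((4 : ℝ) ^ (q + 1) + 2 * (q + 1)) * (‖a‖ ^ (2 * q) * ‖b‖ ^ 2) := by positivity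
    linear_combination e3 + e4
  · have e1 : ‖a + b‖ ^ (2 * (q + 1)) ≤ 4 ^ (q + 1) * ‖b‖ ^ (2 * (q + 1)) := by
      calc ‖a + b‖ ^ (2 * (q + 1)) ≤ (2 * ‖b‖) ^ (2 * (q + 1)) := by
            refine pow_le_pow_left₀ (norm_nonneg _) ((norm_add_le _ _).trans (by linarith)) _
        _ = _ := by rw [mul_pow, pow_mul 2 2]; norm_num
    have e2 : ‖a‖ ^ (2 * q) * -r ≤ ‖b‖ ^ (2 * (q + 1)) := by
      calc ‖a‖ ^ (2 * q) * -r ≤ ‖b‖ ^ (2 * q) * (‖b‖ * ‖b‖) := by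
            have : -r ≤ ‖b‖ * ‖b‖ := (neg_le_abs r).trans
              (hre.trans (mul_le_mul_of_nonneg_right hab (norm_nonneg _)))
            exact mul_le_mul_of_nonneg (pow_le_pow_left₀ (norm_nonneg _) hab _) this
              (by positivity) (by positivity)
        _ = _ := by ring
    have e3 : 0 ≤ ‖a‖ ^ (2 * (q + 1)) := by positivity
    have e4 : 0 ≤ (C + (q + 1) + 4 ^ (q + 1) + 2 * (q + 1)) * (‖a‖ ^ (2 * q) * ‖b‖ ^ 2) := by
      positivity
    have e5 : 0 ≤ (C + (q + 1)) * ‖b‖ ^ (2 * (q + 1)) := by positivity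
    have e6 := mul_le_mul_of_nonneg_left e2 (show (0:ℝ) ≤ 2 * (q + 1) by positivity)
    linear_combination e1 + e3 + e4 + e5 + e6

end Smoothness

/-! ### Moment growth when a centred increment is added. -/

section Orthogonal

variable {Ω : Type*} [MeasurableSpace Ω] {μ : Measure Ω}

theorem integrable_norm_pow_of_memLp {f : Ω → ℂ} {n : ℕ} (hn : n ≠ 0) (hf : MemLp f n μ) :
    Integrable (fun ω => ‖f ω‖ ^ n) μ := by
  simpa using hf.integrable_norm_pow hn

theorem lintegral_enorm_pow_eq {f : Ω → ℂ} {n : ℕ} (hn : n ≠ 0) (hf : MemLp f n μ) :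
    ∫⁻ ω, ‖f ω‖ₑ ^ n ∂μ = ENNReal.ofReal (∫ ω, ‖f ω‖ ^ n ∂μ) := by
  rw [ofReal_integral_eq_lintegral_ofReal (integrable_norm_pow_of_memLp hn hf)
    (Eventually.of_forall fun ω => by positivity)]
  refine lintegral_congr fun ω => ?_
  rw [ENNReal.ofReal_pow (norm_nonneg _), ofReal_norm]

theorem norm_pow_mul_sq_le (q : ℕ) (x y : ℝ) (hx : 0 ≤ x) (hy : 0 ≤ y) :
    x ^ (2 * q) * y ^ 2 ≤ x ^ (2 * (q + 1)) + y ^ (2 * (q + 1)) := by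
  rcases le_total x y with h | h
  · have := mul_le_mul_of_nonneg_right (pow_le_pow_left₀ hx h (2 * q)) (sq_nonneg y)
    have : 0 ≤ x ^ (2 * (q + 1)) := by positivity
    linarith [show y ^ (2 * q) * y ^ 2 = y ^ (2 * (q + 1)) by ring]
  · have := mul_le_mul_of_nonneg_left (pow_le_pow_left₀ hy h 2) (pow_nonneg hx (2 * q))
    have : 0 ≤ y ^ (2 * (q + 1)) := by positivity
    linarith [show x ^ (2 * q) * x ^ 2 = x ^ (2 * (q + 1)) by ring]

theorem integrable_norm_pow_mul_sq {q : ℕ} {g h : Ω → ℂ} (hg : MemLp g (2 * (q + 1) : ℕ) μ)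
    (hh : MemLp h (2 * (q + 1) : ℕ) μ) :
    Integrable (fun ω => ‖g ω‖ ^ (2 * q) * ‖h ω‖ ^ 2) μ := by
  refine ((integrable_norm_pow_of_memLp (by positivity) hg).add
    (integrable_norm_pow_of_memLp (by positivity) hh)).mono
    ((hg.1.norm.pow _).mul (hh.1.norm.pow _)) (Eventually.of_forall fun ω => ?_)
  simp only [Pi.add_apply]
  rw [Real.norm_of_nonneg (by positivity), Real.norm_of_nonneg (by positivity)]
  exact norm_pow_mul_sq_le q _ _ (norm_nonneg _) (norm_nonneg _)

/-- Hölder with weights $q/(q+1)$ and $1/(q+1)$ applied to the two $2(q+1)$-th powers. -/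
theorem integral_norm_pow_mul_sq_le {q : ℕ} {g h : Ω → ℂ} (hg : MemLp g (2 * (q + 1) : ℕ) μ)
    (hh : MemLp h (2 * (q + 1) : ℕ) μ) {a b : ℝ} (ha : 0 ≤ a) (hb : 0 ≤ b)
    (hga : ∫ ω, ‖g ω‖ ^ (2 * (q + 1)) ∂μ ≤ a ^ (q + 1))
    (hhb : ∫ ω, ‖h ω‖ ^ (2 * (q + 1)) ∂μ ≤ b ^ (q + 1)) :
    ∫ ω, ‖g ω‖ ^ (2 * q) * ‖h ω‖ ^ 2 ∂μ ≤ a ^ q * b := by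
  have hq : (0 : ℝ) < q + 1 := by positivity
  have H := ENNReal.lintegral_mul_norm_pow_le (μ := μ)
    (f := fun ω => ‖g ω‖ₑ ^ (2 * (q + 1))) (g := fun ω => ‖h ω‖ₑ ^ (2 * (q + 1)))
    (hg.1.enorm.pow_const _) (hh.1.enorm.pow_const _)
    (p := q / (q + 1)) (q := 1 / (q + 1)) (by positivity) (by positivity) (by field_simp)
  have root : ∀ x : ℝ≥0∞, (x ^ (q + 1)) ^ (1 / ((q : ℝ) + 1)) = x := fun x => by
    rw [← ENNReal.rpow_natCast, ← ENNReal.rpow_mul]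
    push_cast
    rw [mul_one_div_cancel hq.ne', ENNReal.rpow_one]
  have root' : ∀ x : ℝ≥0∞, (x ^ (q + 1)) ^ ((q : ℝ) / ((q : ℝ) + 1)) = x ^ q := fun x => by
    rw [← ENNReal.rpow_natCast, ← ENNReal.rpow_mul, ← ENNReal.rpow_natCast]
    push_cast
    rw [mul_div_cancel₀ _ hq.ne']
  simp only [pow_mul, root, root'] at H
  simp only [← pow_mul] at H
  rw [lintegral_enorm_pow_eq (by positivity) hg, lintegral_enorm_pow_eq (by positivity) hh] at H
  have H2 : ENNReal.ofReal (∫ ω, ‖g ω‖ ^ (2 * q) * ‖h ω‖ ^ 2 ∂μ) ≤ ENNReal.ofReal (a ^ q * b) := by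
    rw [ofReal_integral_eq_lintegral_ofReal (integrable_norm_pow_mul_sq hg hh)
      (Eventually.of_forall fun ω => by positivity)]
    refine le_trans (le_of_eq (lintegral_congr fun ω => ?_)) (H.trans ?_)
    · rw [ENNReal.ofReal_mul (by positivity), ENNReal.ofReal_pow (norm_nonneg _),
        ENNReal.ofReal_pow (norm_nonneg _), ofReal_norm, ofReal_norm]
    · rw [ENNReal.ofReal_mul (by positivity), ENNReal.ofReal_pow ha]
      refine mul_le_mul' ?_ ?_
      · rw [← root' (ENNReal.ofReal a), ← ENNReal.ofReal_pow ha]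
        exact ENNReal.rpow_le_rpow (ENNReal.ofReal_le_ofReal hga) (by positivity)
      · rw [← root (ENNReal.ofReal b), ← ENNReal.ofReal_pow hb]
        exact ENNReal.rpow_le_rpow (ENNReal.ofReal_le_ofReal hhb) (by positivity)
  exact (ENNReal.ofReal_le_ofReal_iff (by positivity)).mp H2

/-- Uniform smoothness of `L^{2(q+1)}` in the form used for martingale increments. -/
theorem integral_norm_add_pow_le (q : ℕ) : ∃ C : ℝ, 1 ≤ C ∧
    ∀ {Ω : Type*} [MeasurableSpace Ω] {μ : Measure Ω} {g h : Ω → ℂ} {a b : ℝ},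
      MemLp g (2 * (q + 1) : ℕ) μ → MemLp h (2 * (q + 1) : ℕ) μ → 0 ≤ a → 0 ≤ b →
      ∫ ω, ‖g ω‖ ^ (2 * (q + 1)) ∂μ ≤ a ^ (q + 1) →
      ∫ ω, ‖h ω‖ ^ (2 * (q + 1)) ∂μ ≤ b ^ (q + 1) →
      Integrable (fun ω => ‖g ω‖ ^ (2 * q) * (conj (g ω) * h ω).re) μ →
      ∫ ω, ‖g ω‖ ^ (2 * q) * (conj (g ω) * h ω).re ∂μ = 0 →
      ∫ ω, ‖g ω + h ω‖ ^ (2 * (q + 1)) ∂μ ≤ (a + C * b) ^ (q + 1) := by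
  obtain ⟨C, hC, hpt⟩ := norm_add_pow_le_taylor q
  refine ⟨2 * C, by linarith, ?_⟩
  intro Ω _ μ g h a b hg hh ha hb hga hhb hint hzero
  have ig := integrable_norm_pow_of_memLp (by positivity) hg
  have ih := integrable_norm_pow_of_memLp (by positivity) hh
  have igh := integrable_norm_pow_of_memLp (by positivity) (hg.add hh)
  have im := integrable_norm_pow_mul_sq hg hh
  have i₁ : Integrable (fun ω => ‖g ω‖ ^ (2 * (q + 1)) +
      2 * (q + 1) * (‖g ω‖ ^ (2 * q) * (conj (g ω) * h ω).re)) μ := ig.add (hint.const_mul _)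
  have i₂ : Integrable (fun ω =>
      C * (‖g ω‖ ^ (2 * q) * ‖h ω‖ ^ 2 + ‖h ω‖ ^ (2 * (q + 1)))) μ := (im.add ih).const_mul _
  have h1 : ∫ ω, ‖g ω + h ω‖ ^ (2 * (q + 1)) ∂μ ≤
      a ^ (q + 1) + C * (a ^ q * b + b ^ (q + 1)) := by
    calc _ ≤ ∫ ω, (‖g ω‖ ^ (2 * (q + 1)) +
            2 * (q + 1) * (‖g ω‖ ^ (2 * q) * (conj (g ω) * h ω).re) +
            C * (‖g ω‖ ^ (2 * q) * ‖h ω‖ ^ 2 + ‖h ω‖ ^ (2 * (q + 1)))) ∂μ :=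
          integral_mono igh (i₁.add i₂) fun ω => hpt _ _
      _ = ∫ ω, ‖g ω‖ ^ (2 * (q + 1)) ∂μ +
            C * (∫ ω, ‖g ω‖ ^ (2 * q) * ‖h ω‖ ^ 2 ∂μ + ∫ ω, ‖h ω‖ ^ (2 * (q + 1)) ∂μ) := by
          rw [integral_add i₁ i₂,
            integral_add ig (hint.const_mul _), integral_const_mul, integral_const_mul, hzero,
            integral_add im ih]
          ring
      _ ≤ _ := by
          have := integral_norm_pow_mul_sq_le hg hh ha hb hga hhb
          gcongr
  -- The left side is at most the average of the three estimates below; this averaging is why the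
  -- constant is $2C$.
  refine h1.trans ?_
  have e1 : a ^ q * a + a ^ q * (2 * C * b) ≤ (a + 2 * C * b) ^ (q + 1) := by
    rw [pow_succ (a + _), ← mul_add]
    have : 0 ≤ 2 * C * b := by positivity
    exact mul_le_mul_of_nonneg_right (pow_le_pow_left₀ ha (by linarith) q) (by positivity)
  have e2 : a ^ (q + 1) + (2 * C * b) ^ (q + 1) ≤ (a + 2 * C * b) ^ (q + 1) :=
    pow_add_pow_le ha (by positivity) (by positivity)
  have e3 : 2 * C * b ^ (q + 1) ≤ (2 * C * b) ^ (q + 1) := by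
    rw [mul_pow]
    refine mul_le_mul_of_nonneg_right ?_ (by positivity)
    exact le_self_pow₀ (by linarith) (by positivity)
  linear_combination (e1 + e2 + e3) / 2

end Orthogonal

/-! ### Moments of multilinear expressions in independent variables. -/

section Chaos

open ProbabilityTheory

variable {Ω : Type*} [MeasurableSpace Ω] {μ : Measure Ω}

theorem norm_sum_pow_le {J : Type*} (s : Finset J) (x : J → ℂ) (n : ℕ) :
    ‖∑ j ∈ s, x j‖ ^ (n + 1) ≤ (s.card : ℝ) ^ n * ∑ j ∈ s, ‖x j‖ ^ (n + 1) := by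
  refine (pow_le_pow_left₀ (norm_nonneg _) (norm_sum_le _ _) _).trans ?_
  rcases s.eq_empty_or_nonempty with rfl | hs
  · simp
  · have := pow_sum_div_card_le_sum_pow (s := s) (f := fun j => ‖x j‖) (fun _ _ => norm_nonneg _) n
    rwa [div_le_iff₀' (by have := hs.card_pos; positivity)] at this

theorem sum_pow_le_pow_sum_of_nonneg {J : Type*} (s : Finset J) {x : J → ℝ} (hx : ∀ j, 0 ≤ x j)
    (n : ℕ) : ∑ j ∈ s, x j ^ (n + 1) ≤ (∑ j ∈ s, x j) ^ (n + 1) := by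
  rw [pow_succ, Finset.mul_sum]
  refine Finset.sum_le_sum fun j hj => ?_
  rw [pow_succ]
  exact mul_le_mul_of_nonneg_right (pow_le_pow_left₀ (hx j)
    (Finset.single_le_sum (fun j _ => hx j) hj) n) (hx j)

theorem memLp_mul_of_indepFun {n : ℕ} (hn : n ≠ 0) {X Y : Ω → ℂ} (h : IndepFun X Y μ)
    (hX : MemLp X n μ) (hY : MemLp Y n μ) : MemLp (fun ω => X ω * Y ω) n μ ∧
      ∫ ω, ‖X ω * Y ω‖ ^ n ∂μ = (∫ ω, ‖X ω‖ ^ n ∂μ) * ∫ ω, ‖Y ω‖ ^ n ∂μ := by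
  have hind : IndepFun (fun ω => ‖X ω‖ ^ n) (fun ω => ‖Y ω‖ ^ n) μ :=
    h.comp (φ := fun z : ℂ => ‖z‖ ^ n) (ψ := fun z : ℂ => ‖z‖ ^ n) (by fun_prop) (by fun_prop)
  have iX := integrable_norm_pow_of_memLp hn hX
  have iY := integrable_norm_pow_of_memLp hn hY
  constructor
  · refine ⟨hX.1.mul hY.1, ?_⟩
    have := hind.integrable_mul iX iY
    rw [← memLp_one_iff_integrable] at this
    have hfin := (integrable_norm_rpow_iff (p := (n : ℝ≥0∞)) (hX.1.mul hY.1)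
      (by simpa using hn) (by simp)).mp ?_
    · exact hfin.2
    · rw [memLp_one_iff_integrable] at this
      refine this.congr (Eventually.of_forall fun ω => ?_)
      simp [mul_pow]
  · simp only [norm_mul, mul_pow]
    exact hind.integral_fun_mul_eq_mul_integral iX.1 iY.1

/-- The weight `1` on the trivial index and `K` on all others. -/
def chaosWeight {J : Type*} [DecidableEq J] [Zero J] (K : ℝ) (j : J) : ℝ := if j = 0 then 1 else K

/-- Moment bound for multilinear expressions in independent random variables: each summand is a
product over `I` of factors `e i j (X i)`, where the factor is `1` for `j = 0` and centred
otherwise, and any pattern of indices occurs at most `L` times. -/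
theorem chaos_moment_le (q L : ℕ) (J : Type*) [Fintype J] [DecidableEq J] [Zero J]
    {M : ℝ} (hM : 1 ≤ M) : ∃ K : ℝ, 1 ≤ K ∧
    ∀ {Ω ι T : Type*} [MeasurableSpace Ω] {μ : Measure Ω} [IsProbabilityMeasure μ] [DecidableEq ι]
      {X : ι → Ω → ℂ} {e : ι → J → ℂ → ℂ},
      (∀ i, Measurable (X i)) → iIndepFun X μ → (∀ i j, Measurable (e i j)) →
      (∀ i z, e i 0 z = 1) → (∀ i j, j ≠ 0 → ∫ ω, e i j (X i ω) ∂μ = 0) →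
      (∀ i j, MemLp (fun ω => e i j (X i ω)) (2 * (q + 1) : ℕ) μ) →
      (∀ i j, ∫ ω, ‖e i j (X i ω)‖ ^ (2 * (q + 1)) ∂μ ≤ M) →
      ∀ (I : Finset ι) (S : Finset T) (c : T → ℂ) (α : T → ι → J),
      (∀ t ∈ S, {t' ∈ S | ∀ i ∈ I, α t' i = α t i}.card ≤ L) →
      MemLp (fun ω => ∑ t ∈ S, c t * ∏ i ∈ I, e i (α t i) (X i ω)) (2 * (q + 1) : ℕ) μ ∧
      ∫ ω, ‖∑ t ∈ S, c t * ∏ i ∈ I, e i (α t i) (X i ω)‖ ^ (2 * (q + 1)) ∂μ ≤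
        (L * ∑ t ∈ S, ‖c t‖ ^ 2 * ∏ i ∈ I, chaosWeight K (α t i)) ^ (q + 1) := by
  obtain ⟨C, hC, hsmooth⟩ := integral_norm_add_pow_le q
  set m : ℝ := (Fintype.card J : ℝ) with hm
  have hm1 : 1 ≤ m := by
    rw [hm]; exact_mod_cast Fintype.card_pos_iff.mpr ⟨(0 : J)⟩
  have hn0 : 2 * (q + 1) ≠ 0 := by positivity
  -- $C$ is the smoothness constant, $M$ the moment of one factor, and $m^2$ the cost of summing
  -- over at most $m$ indices inside the norm.
  refine ⟨C * (m ^ 2 * M), ?_, ?_⟩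
  · have : 1 ≤ m ^ 2 * M := one_le_mul_of_one_le_of_one_le (one_le_pow₀ hm1) hM
    exact one_le_mul_of_one_le_of_one_le hC this
  intro Ω ι T _ μ _ _ X e hX hind he he0 hmean hLp hmom I
  induction I using Finset.induction_on with
  | empty =>
    intro S c α hfib
    simp only [Finset.prod_empty, mul_one]
    refine ⟨memLp_const _, ?_⟩
    simp only [integral_const, probReal_univ, one_smul]
    rw [pow_mul]
    refine pow_le_pow_left₀ (by positivity) ?_ _
    -- With no variables left all patterns agree, so there are at most $L$ terms and Cauchy–Schwarz
    -- costs a factor $L$.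
    rcases S.eq_empty_or_nonempty with rfl | ⟨t, ht⟩
    · simp
    have hcard : S.card ≤ L := by simpa using hfib t ht
    refine (norm_sum_pow_le S c 1).trans ?_
    rw [pow_one]
    refine mul_le_mul_of_nonneg_right (by exact_mod_cast hcard) (by positivity)
  | insert i I hi ih =>
    intro S c α hfib
    set n := 2 * (q + 1) with hn
    set K := C * (m ^ 2 * M) with hK
    let F : J → Ω → ℂ := fun j ω =>
      ∑ t ∈ S with α t i = j, c t * ∏ i ∈ I, e i (α t i) (X i ω)
    let B : J → ℝ := fun j =>
      L * ∑ t ∈ S with α t i = j, ‖c t‖ ^ 2 * ∏ i ∈ I, chaosWeight K (α t i)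
    have hK1 : 1 ≤ K := one_le_mul_of_one_le_of_one_le hC
      (one_le_mul_of_one_le_of_one_le (one_le_pow₀ hm1) hM)
    have hw : ∀ j : J, 0 ≤ chaosWeight K j := fun j => by
      unfold chaosWeight; split_ifs <;> linarith
    have hB0 : ∀ j, 0 ≤ B j := fun j => mul_nonneg (by positivity)
      (Finset.sum_nonneg fun t _ => mul_nonneg (by positivity) (Finset.prod_nonneg fun i _ => hw _))
    have hF : ∀ j, MemLp (F j) n μ ∧ ∫ ω, ‖F j ω‖ ^ n ∂μ ≤ B j ^ (q + 1) := by
      intro j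
      refine ih {t ∈ S | α t i = j} c α fun t ht => ?_
      rw [Finset.mem_filter] at ht
      refine le_trans (Finset.card_le_card fun t' ht' => ?_) (hfib t ht.1)
      simp only [Finset.mem_filter] at ht' ⊢
      refine ⟨ht'.1.1, fun i' hi' => ?_⟩
      rcases Finset.mem_insert.mp hi' with rfl | hi'
      · rw [ht'.1.2, ht.2]
      · exact ht'.2 i' hi'
    have hpair : IndepFun (X i) (fun ω (i' : I) => X i' ω) μ :=
      (hind.indepFun_finset {i} I (Finset.disjoint_singleton_left.mpr hi) hX).comp
        (φ := fun a : (({i} : Finset ι) → ℂ) => a ⟨i, Finset.mem_singleton_self i⟩)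
        (measurable_pi_apply _) measurable_id
    let G : J → (I → ℂ) → ℂ := fun j x =>
      ∑ t ∈ S with α t i = j, c t * ∏ i' : I, e i' (α t i') (x i')
    have hGm : ∀ j, Measurable (G j) := fun j =>
      Finset.measurable_fun_sum _ fun t _ => (Finset.measurable_fun_prod _ fun i' _ =>
        (he _ _).comp (measurable_pi_apply _)).const_mul _
    have hFG : ∀ j ω, F j ω = G j (fun i' => X i' ω) := by
      intro j ω
      simp only [F, G]
      refine Finset.sum_congr rfl fun t _ => ?_
      rw [← Finset.prod_coe_sort I (fun i => e i (α t i) (X i ω))]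
    -- The terms are grouped by their index at the new variable $X_i$. `F 0` does not involve $X_i$,
    -- while the rest has a centred factor in $X_i$ independent of every `F j`.
    have hsplit : ∀ ω, ∑ t ∈ S, c t * ∏ i ∈ insert i I, e i (α t i) (X i ω) =
        F 0 ω + ∑ j ∈ Finset.univ.erase 0, e i j (X i ω) * F j ω := by
      intro ω
      rw [← Finset.sum_fiberwise S (fun t => α t i), ← Finset.add_sum_erase _ _ (Finset.mem_univ 0)]
      have : ∀ j, ∑ t ∈ S with α t i = j, c t * ∏ i ∈ insert i I, e i (α t i) (X i ω) =
          e i j (X i ω) * F j ω := by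
        intro j
        rw [Finset.mul_sum]
        refine Finset.sum_congr rfl fun t ht => ?_
        rw [Finset.prod_insert hi, (Finset.mem_filter.mp ht).2]
        ring
      simp only [this, he0, one_mul]
    have hmul : ∀ j, MemLp (fun ω => e i j (X i ω) * F j ω) n μ ∧
        ∫ ω, ‖e i j (X i ω) * F j ω‖ ^ n ∂μ ≤ M * B j ^ (q + 1) := by
      intro j
      have hij : IndepFun (fun ω => e i j (X i ω)) (F j) μ := by
        rw [show F j = fun ω => G j (fun i' => X i' ω) from funext (hFG j)]
        exact hpair.comp (he i j) (hGm j)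
      obtain ⟨h1, h2⟩ := memLp_mul_of_indepFun hn0 hij (hLp i j) (hF j).1
      refine ⟨h1, h2.le.trans ?_⟩
      exact mul_le_mul (hmom i j) (hF j).2 (by positivity) (by linarith)
    let H : Ω → ℂ := fun ω => ∑ j ∈ Finset.univ.erase 0, e i j (X i ω) * F j ω
    have hHLp : MemLp H n μ := memLp_finsetSum _ fun j _ => (hmul j).1
    set b : ℝ := m ^ 2 * M * ∑ j ∈ Finset.univ.erase 0, B j with hb
    have hsumB : 0 ≤ ∑ j ∈ Finset.univ.erase 0, B j := Finset.sum_nonneg fun j _ => hB0 j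
    have hHb : ∫ ω, ‖H ω‖ ^ n ∂μ ≤ b ^ (q + 1) := by
      have hint : ∀ j, Integrable (fun ω => ‖e i j (X i ω) * F j ω‖ ^ n) μ := fun j =>
        integrable_norm_pow_of_memLp hn0 (hmul j).1
      have hpt : ∀ ω, ‖H ω‖ ^ n ≤ m ^ n * ∑ j ∈ Finset.univ.erase 0,
          ‖e i j (X i ω) * F j ω‖ ^ n := by
        intro ω
        refine (norm_sum_pow_le _ _ (2 * q + 1)).trans ?_
        refine mul_le_mul_of_nonneg_right ?_ (by positivity)
        calc ((Finset.univ.erase (0 : J)).card : ℝ) ^ (2 * q + 1) ≤ m ^ (2 * q + 1) := by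
              refine pow_le_pow_left₀ (by positivity) ?_ _
              rw [hm]
              exact_mod_cast Finset.card_le_univ _
          _ ≤ m ^ n := pow_le_pow_right₀ hm1 (by omega)
      calc ∫ ω, ‖H ω‖ ^ n ∂μ
          ≤ ∫ ω, m ^ n * ∑ j ∈ Finset.univ.erase 0, ‖e i j (X i ω) * F j ω‖ ^ n ∂μ :=
            integral_mono (integrable_norm_pow_of_memLp hn0 hHLp)
              ((integrable_finsetSum _ fun j _ => hint j).const_mul _) hpt
        _ = m ^ n * ∑ j ∈ Finset.univ.erase 0, ∫ ω, ‖e i j (X i ω) * F j ω‖ ^ n ∂μ := by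
            rw [integral_const_mul, integral_finsetSum _ fun j _ => hint j]
        _ ≤ m ^ n * ∑ j ∈ Finset.univ.erase 0, M * B j ^ (q + 1) := by
            gcongr with j _
            exact (hmul j).2
        _ = m ^ n * M * ∑ j ∈ Finset.univ.erase 0, B j ^ (q + 1) := by
            rw [← Finset.mul_sum, mul_assoc]
        _ ≤ m ^ n * M ^ (q + 1) * (∑ j ∈ Finset.univ.erase 0, B j) ^ (q + 1) := by
            gcongr
            · exact Finset.sum_nonneg fun j _ => pow_nonneg (hB0 j) _
            · exact le_self_pow₀ hM (by positivity)
            · exact sum_pow_le_pow_sum_of_nonneg _ hB0 q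
        _ = b ^ (q + 1) := by
            rw [hb, mul_pow, mul_pow, hn, pow_mul]
    -- The factor in $X_i$ is independent of everything built from the variables in `I` and has mean
    -- zero; this kills the first-order Taylor term.
    have hcross : ∀ j ≠ 0, Integrable (fun ω =>
        e i j (X i ω) * (((‖F 0 ω‖ ^ (2 * q) : ℝ) : ℂ) * conj (F 0 ω) * F j ω)) μ ∧
        ∫ ω, e i j (X i ω) * (((‖F 0 ω‖ ^ (2 * q) : ℝ) : ℂ) * conj (F 0 ω) * F j ω) ∂μ = 0 := by
      intro j hj
      let R : (I → ℂ) → ℂ := fun x => ((‖G 0 x‖ ^ (2 * q) : ℝ) : ℂ) * conj (G 0 x) * G j x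
      have hRm : Measurable R := by
        have := hGm 0
        have := hGm j
        have : Measurable (fun x => conj (G 0 x)) := Complex.continuous_conj.measurable.comp (hGm 0)
        fun_prop
      have hij : IndepFun (fun ω => e i j (X i ω))
          (fun ω => ((‖F 0 ω‖ ^ (2 * q) : ℝ) : ℂ) * conj (F 0 ω) * F j ω) μ := by
        simp only [hFG]
        exact hpair.comp (ψ := R) (he i j) hRm
      have hRint : Integrable (fun ω => ((‖F 0 ω‖ ^ (2 * q) : ℝ) : ℂ) * conj (F 0 ω) * F j ω)
          μ := by
        have hmeas : AEStronglyMeasurable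
            (fun ω => ((‖F 0 ω‖ ^ (2 * q) : ℝ) : ℂ) * conj (F 0 ω) * F j ω) μ := by
          simp only [hFG]
          exact (hRm.comp (measurable_pi_lambda _ fun i' => hX i')).aestronglyMeasurable
        refine ((integrable_norm_pow_of_memLp hn0 (hF 0).1).add
          (integrable_norm_pow_mul_sq (hF 0).1 (hF j).1)).mono hmeas
          (Eventually.of_forall fun ω => ?_)
        simp only [norm_mul, Complex.norm_real, Pi.add_apply, norm_pow, norm_norm, RCLike.norm_conj]
        rw [Real.norm_of_nonneg (by positivity), mul_assoc, hn,
          show ‖F 0 ω‖ ^ (2 * (q + 1)) = ‖F 0 ω‖ ^ (2 * q) * ‖F 0 ω‖ ^ 2 by ring, ← mul_add]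
        refine mul_le_mul_of_nonneg_left ?_ (by positivity)
        nlinarith [sq_nonneg (‖F 0 ω‖ - ‖F j ω‖), norm_nonneg (F 0 ω), norm_nonneg (F j ω)]
      refine ⟨hij.integrable_mul ((hLp i j).integrable (by
        rw [hn]; exact_mod_cast Nat.one_le_iff_ne_zero.mpr hn0)) hRint, ?_⟩
      rw [hij.integral_fun_mul_eq_mul_integral (hLp i j).1 hRint.1, hmean i j hj, zero_mul]
    have hre : ∀ ω, ‖F 0 ω‖ ^ (2 * q) * (conj (F 0 ω) * H ω).re =
        (∑ j ∈ Finset.univ.erase 0,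
          e i j (X i ω) * (((‖F 0 ω‖ ^ (2 * q) : ℝ) : ℂ) * conj (F 0 ω) * F j ω)).re := by
      intro ω
      rw [← Complex.re_ofReal_mul]
      congr 1
      simp only [H, Finset.mul_sum]
      exact Finset.sum_congr rfl fun j _ => by ring
    have hsumint : Integrable (fun ω => ∑ j ∈ Finset.univ.erase 0,
        e i j (X i ω) * (((‖F 0 ω‖ ^ (2 * q) : ℝ) : ℂ) * conj (F 0 ω) * F j ω)) μ :=
      integrable_finsetSum _ fun j hj => (hcross j (Finset.ne_of_mem_erase hj)).1
    have hfinal := hsmooth (hF 0).1 hHLp (hB0 0) (by positivity : 0 ≤ b) (hF 0).2 hHb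
      (by simp only [hre]; exact hsumint.re)
      (by
        simp only [hre]
        have := integral_re hsumint
        simp only [RCLike.re_eq_complex_re] at this
        rw [this, integral_finsetSum _ fun j hj => (hcross j (Finset.ne_of_mem_erase hj)).1,
          Finset.sum_eq_zero fun j hj => (hcross j (Finset.ne_of_mem_erase hj)).2, Complex.zero_re])
    -- The new variable multiplies the group `j = 0` by $1$ and every other group by $K$, which is
    -- exactly the growth $a+Cb$ of the smoothness inequality.
    have htotal : L * ∑ t ∈ S, ‖c t‖ ^ 2 * ∏ i ∈ insert i I, chaosWeight K (α t i) =
        B 0 + C * b := by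
      rw [← Finset.sum_fiberwise S (fun t => α t i), ← Finset.add_sum_erase _ _ (Finset.mem_univ 0)]
      have : ∀ j, L * ∑ t ∈ S with α t i = j, ‖c t‖ ^ 2 *
          ∏ i ∈ insert i I, chaosWeight K (α t i) = chaosWeight K j * B j := by
        intro j
        simp only [B, Finset.mul_sum]
        refine Finset.sum_congr rfl fun t ht => ?_
        rw [Finset.prod_insert hi, (Finset.mem_filter.mp ht).2]
        ring
      rw [mul_add, this, Finset.mul_sum, Finset.sum_congr rfl fun j _ => this j]
      rw [hb, Finset.mul_sum, Finset.mul_sum]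
      congr 1
      · simp [chaosWeight]
      · refine Finset.sum_congr rfl fun j hj => ?_
        rw [chaosWeight, if_neg (Finset.ne_of_mem_erase hj), hK]
        ring
    simp only [hsplit]
    rw [htotal]
    exact ⟨(hF 0).1.add hHLp, hfinal⟩

end Chaos

/-! ### Gaussian moments and Hermite polynomials of one mode. -/

section Gaussian

instance (d : ℕ) (a : ℝ) : IsProbabilityMeasure (mu d a) := by
  unfold mu; infer_instance

theorem len_rpow_two (k : Freq d) : len k.1 ^ (2 : ℝ) = len k.1 ^ 2 := Real.rpow_two _

theorem integral_modeLaw {E : Type*} [NormedAddCommGroup E] [NormedSpace ℝ E] (k : Freq d)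
    (f : ℂ → E) : ∫ z, f z ∂modeLaw 2 k =
      ∫ z : ℂ, (len k.1 ^ 2 / (2 * Real.pi) * Real.exp (-(len k.1 ^ 2 / 2) * ‖z‖ ^ 2)) • f z := by
  rw [modeLaw, integral_withDensity_eq_integral_toReal_smul (by fun_prop)
    (Eventually.of_forall fun z => ENNReal.ofReal_lt_top)]
  refine integral_congr_ae (Eventually.of_forall fun z => ?_)
  simp only [len_rpow_two]
  rw [ENNReal.toReal_ofReal]
  have := Real.pi_pos
  positivity

/-- The absolute moment of order `n` of a standard complex Gaussian with `E|z|² = 2`. -/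
def gaussMoment (n : ℕ) : ℝ := 2 ^ ((n : ℝ) / 2) * Real.Gamma ((n + 2) / 2)

theorem gaussMoment_pos (n : ℕ) : 0 < gaussMoment n :=
  mul_pos (by positivity) (Real.Gamma_pos_of_pos (by positivity))

/-- After rescaling by $|k|$ the law no longer depends on $k$, so all later moment bounds are
uniform in the frequency. -/
theorem integral_modeLaw_norm_pow (k : Freq d) (n : ℕ) :
    ∫ z, ‖(len k.1 : ℂ) * z‖ ^ n ∂modeLaw 2 k = gaussMoment n := by
  have hr := len_pos k
  set r := len k.1 with hrdef
  have hb : 0 < r ^ 2 / 2 := by positivity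
  have H := Complex.integral_rpow_mul_exp_neg_mul_rpow (p := 2) (q := n) one_le_two
    (by have : (0 : ℝ) ≤ n := by positivity
        linarith) hb
  simp only [Real.rpow_natCast, Real.rpow_two] at H
  rw [integral_modeLaw]
  have : ∀ z : ℂ, (r ^ 2 / (2 * Real.pi) * Real.exp (-(r ^ 2 / 2) * ‖z‖ ^ 2)) •
      ‖(r : ℂ) * z‖ ^ n = r ^ 2 / (2 * Real.pi) * r ^ n *
        (‖z‖ ^ n * Real.exp (-(r ^ 2 / 2) * ‖z‖ ^ 2)) := fun z => by
    rw [norm_mul, Complex.norm_real, Real.norm_of_nonneg hr.le, mul_pow, smul_eq_mul]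
    ring
  simp only [← hrdef, this]
  rw [integral_const_mul, H, gaussMoment]
  have e1 : (r ^ 2 / 2) ^ (-((n : ℝ) + 2) / 2) = 2 ^ ((n : ℝ) / 2) * 2 / (r ^ n * r ^ 2) := by
    rw [Real.div_rpow (by positivity) (by positivity), ← Real.rpow_natCast r 2,
      ← Real.rpow_mul hr.le,
      show ((2 : ℕ) : ℝ) * (-((n : ℝ) + 2) / 2) = -((n + 2 : ℕ) : ℝ) by push_cast; ring,
      Real.rpow_neg hr.le, Real.rpow_natCast, Real.rpow_natCast,
      show -((n : ℝ) + 2) / 2 = -((n : ℝ) / 2 + 1) by ring, Real.rpow_neg (by positivity),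
      Real.rpow_add (by positivity), Real.rpow_one, pow_add]
    field_simp
  rw [e1]
  have := Real.pi_pos
  field_simp

theorem integrable_modeLaw_norm_pow (k : Freq d) (n : ℕ) :
    Integrable (fun z => ‖(len k.1 : ℂ) * z‖ ^ n) (modeLaw 2 k) := by
  -- A non-integrable function would have integral $0$ by convention, whereas the computed moment is
  -- positive.
  by_contra h
  have := integral_modeLaw_norm_pow k n
  rw [integral_undef h] at this
  exact (gaussMoment_pos n).ne this

/-- The Gaussian density is invariant under rotation by $i$, so the integral equals $c$ times
itself. -/
theorem integral_modeLaw_eq_zero (k : Freq d) {f : ℂ → ℂ} {c : ℂ} (hc : c ≠ 1)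
    (hf : ∀ z, f (Complex.I * z) = c * f z) : ∫ z, f z ∂modeLaw 2 k = 0 := by
  rw [integral_modeLaw]
  set F : ℂ → ℂ := fun z =>
    (len k.1 ^ 2 / (2 * Real.pi) * Real.exp (-(len k.1 ^ 2 / 2) * ‖z‖ ^ 2)) • f z with hF
  let R : ℂ ≃ₗᵢ[ℝ] ℂ := rotation ⟨Complex.I, by simp [Submonoid.unitSphere]⟩
  have hR : ∀ z, R z = Complex.I * z := fun z => rotation_apply _ z
  have h1 : ∫ z, F (R z) = ∫ z, F z :=
    R.measurePreserving.integral_comp R.toHomeomorph.measurableEmbedding F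
  have h2 : ∀ z, F (R z) = c * F z := fun z => by
    simp only [hF, hR, hf, norm_mul, Complex.norm_I, one_mul, Complex.real_smul]
    ring
  simp only [h2, integral_const_mul] at h1
  have h3 : (c - 1) * ∫ z, F z = 0 := by rw [sub_mul, h1]; ring
  exact (mul_eq_zero.mp h3).resolve_left (sub_ne_zero.mpr hc)

/-- The complex Hermite polynomial with leading term `z^a * conj z ^ b`, for `b ≤ 1` and
variance `E|z|² = 2`. -/
def herm (j : Fin 3 × Fin 2) (z : ℂ) : ℂ :=
  z ^ (j.1 : ℕ) * conj z ^ (j.2 : ℕ) - 2 * (j.1 : ℕ) * (j.2 : ℕ) * z ^ ((j.1 : ℕ) - 1)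

theorem herm_zero (z : ℂ) : herm 0 z = 1 := by simp [herm]

theorem measurable_herm (j : Fin 3 × Fin 2) : Measurable (herm j) := by
  have : Measurable (fun z : ℂ => conj z) := Complex.continuous_conj.measurable
  unfold herm
  fun_prop

theorem norm_herm_le (j : Fin 3 × Fin 2) (z : ℂ) : ‖herm j z‖ ≤ 6 * (1 + ‖z‖ ^ 3) := by
  have hz := norm_nonneg z
  have h1 : ‖herm j z‖ ≤ ‖z‖ ^ (j.1 : ℕ) * ‖z‖ ^ (j.2 : ℕ) +
      2 * (j.1 : ℕ) * (j.2 : ℕ) * ‖z‖ ^ ((j.1 : ℕ) - 1) := by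
    refine (norm_sub_le _ _).trans_eq ?_
    simp
  refine h1.trans ?_
  obtain ⟨a, b⟩ := j
  have e1 : ‖z‖ ≤ 1 + ‖z‖ ^ 3 := by
    nlinarith [sq_nonneg (‖z‖ - 1), mul_nonneg hz (sq_nonneg (‖z‖ - 1))]
  have e2 : ‖z‖ ^ 2 ≤ 1 + ‖z‖ ^ 3 := by
    nlinarith [sq_nonneg (‖z‖ - 1), mul_nonneg hz (sq_nonneg (‖z‖ - 1))]
  have e3 : 0 ≤ ‖z‖ ^ 3 := by positivity
  fin_cases a <;> fin_cases b <;> norm_num <;> nlinarith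

/-- Rotation by $i$ multiplies the polynomial of index $(a,b)$ by $i^{a-b}$, which differs from $1$
for every nonzero index except $(1,1)$. There the subtracted constant $2$ is the variance. -/
theorem integral_herm_modeLaw (k : Freq d) {j : Fin 3 × Fin 2} (hj : j ≠ 0) :
    ∫ z, herm j (len k.1 * z) ∂modeLaw 2 k = 0 := by
  have hrot : ∀ z : ℂ, (len k.1 : ℂ) * (Complex.I * z) = Complex.I * (len k.1 * z) :=
    fun z => by ring
  have hI3 : Complex.I ≠ 1 := fun h => by simpa using congrArg Complex.re h
  have hIn : -Complex.I ≠ 1 := fun h => by simpa using congrArg Complex.re h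
  have h11 : ∫ z, herm (1, 1) (len k.1 * z) ∂modeLaw 2 k = 0 := by
    have : ∀ z : ℂ, herm (1, 1) (len k.1 * z) = ((‖(len k.1 : ℂ) * z‖ ^ 2 - 2 : ℝ) : ℂ) :=
        fun z => by
      simp only [herm]
      push_cast
      rw [← Complex.mul_conj']
      simp
    simp only [this]
    rw [integral_complex_ofReal, integral_sub (integrable_modeLaw_norm_pow k 2)
      (integrable_const _),
      integral_modeLaw_norm_pow]
    have hG : gaussMoment 2 = 2 := by
      have : Real.Gamma 2 = 1 := Real.Gamma_two
      norm_num [gaussMoment, this]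
    simp [hG]
  obtain ⟨a, b⟩ := j
  fin_cases a <;> fin_cases b
  · exact absurd rfl hj
  · refine integral_modeLaw_eq_zero k (c := -Complex.I) hIn fun z => ?_
    simp only [hrot]
    simp [herm]
  · refine integral_modeLaw_eq_zero k (c := Complex.I) hI3 fun z => ?_
    simp only [hrot]
    simp [herm]
  · exact h11
  · refine integral_modeLaw_eq_zero k (c := -1) (by norm_num) fun z => ?_
    simp only [hrot]
    simp [herm, mul_pow]
  · refine integral_modeLaw_eq_zero k (c := Complex.I) hI3 fun z => ?_
    simp only [hrot]
    simp [herm, mul_pow]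
    ring

theorem integral_mu_eval {E : Type*} [NormedAddCommGroup E] [NormedSpace ℝ E] {a : ℝ} (k : Freq d)
    {f : ℂ → E} (hf : AEStronglyMeasurable f (modeLaw a k)) :
    ∫ φ, f (φ k) ∂mu d a = ∫ z, f z ∂modeLaw a k := by
  have := measurePreserving_eval_infinitePi (fun k : Freq d => modeLaw a k) k
  rw [← this.map_eq] at hf ⊢
  exact (integral_map (measurable_pi_apply k).aemeasurable hf).symm

theorem integrable_mu_eval {E : Type*} [NormedAddCommGroup E] {a : ℝ} (k : Freq d)
    {f : ℂ → E} (hf : Integrable f (modeLaw a k)) : Integrable (fun φ => f (φ k)) (mu d a) :=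
  (measurePreserving_eval_infinitePi (fun k : Freq d => modeLaw a k) k).integrable_comp_of_integrable
    hf

theorem lintegral_mu_norm_pow (k : Freq d) (n : ℕ) :
    ∫⁻ φ, ‖(len k.1 : ℂ) * φ k‖ₑ ^ n ∂mu d 2 = ENNReal.ofReal (gaussMoment n) := by
  have hi := integrable_mu_eval k (integrable_modeLaw_norm_pow k n)
  rw [← integral_modeLaw_norm_pow k n, ← integral_mu_eval k (integrable_modeLaw_norm_pow k n).1,
    ofReal_integral_eq_lintegral_ofReal hi (Eventually.of_forall fun φ => by positivity)]
  refine lintegral_congr fun φ => ?_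
  rw [ENNReal.ofReal_pow (norm_nonneg _), ofReal_norm]

theorem integral_mu_herm (k : Freq d) {j : Fin 3 × Fin 2} (hj : j ≠ 0) :
    ∫ φ : Field d, herm j (len k.1 * φ k) ∂mu d 2 = 0 := by
  rw [integral_mu_eval k (f := fun z => herm j (len k.1 * z)), integral_herm_modeLaw k hj]
  exact ((measurable_herm j).comp (measurable_const_mul _)).aestronglyMeasurable

theorem norm_herm_pow_le (j : Fin 3 × Fin 2) (z : ℂ) (n : ℕ) :
    ‖herm j z‖ ^ n ≤ 12 ^ n * (1 + ‖z‖ ^ (3 * n)) := by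
  have hz : 0 ≤ ‖z‖ ^ 3 := by positivity
  calc ‖herm j z‖ ^ n ≤ (12 * max 1 (‖z‖ ^ 3)) ^ n := by
        refine pow_le_pow_left₀ (norm_nonneg _) ((norm_herm_le j z).trans ?_) n
        linarith [le_max_left 1 (‖z‖ ^ 3), le_max_right 1 (‖z‖ ^ 3)]
    _ ≤ _ := by
        rw [mul_pow]
        refine mul_le_mul_of_nonneg_left ?_ (by positivity)
        have : 0 ≤ ‖z‖ ^ (3 * n) := by positivity
        rcases le_total 1 (‖z‖ ^ 3) with h | h
        · rw [max_eq_right h, ← pow_mul]; linarith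
        · rw [max_eq_left h, one_pow]; linarith

theorem integrable_mu_herm_pow (k : Freq d) (j : Fin 3 × Fin 2) (n : ℕ) :
    Integrable (fun φ : Field d => ‖herm j (len k.1 * φ k)‖ ^ n) (mu d 2) ∧
      ∫ φ : Field d, ‖herm j (len k.1 * φ k)‖ ^ n ∂mu d 2 ≤
        12 ^ n * (1 + gaussMoment (3 * n)) := by
  have hi := integrable_mu_eval k (integrable_modeLaw_norm_pow k (3 * n))
  have hi' : Integrable (fun φ : Field d =>
      (12 : ℝ) ^ n * (1 + ‖(len k.1 : ℂ) * φ k‖ ^ (3 * n))) (mu d 2) :=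
    ((integrable_const _).add hi).const_mul _
  have hm : Measurable (fun φ : Field d => herm j (len k.1 * φ k)) :=
    (measurable_herm j).comp ((measurable_pi_apply k).const_mul _)
  have hint : Integrable (fun φ : Field d => ‖herm j (len k.1 * φ k)‖ ^ n) (mu d 2) := by
    refine hi'.mono (hm.norm.pow_const n).aestronglyMeasurable (Eventually.of_forall fun φ => ?_)
    rw [Real.norm_of_nonneg (by positivity), Real.norm_of_nonneg (by positivity)]
    exact norm_herm_pow_le j _ n
  refine ⟨hint, (integral_mono hint hi' fun φ => norm_herm_pow_le j _ n).trans_eq ?_⟩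
  rw [integral_const_mul, integral_add (integrable_const _) hi,
    integral_mu_eval k (f := fun z => ‖(len k.1 : ℂ) * z‖ ^ (3 * n))
      (integrable_modeLaw_norm_pow k _).1, integral_modeLaw_norm_pow]
  simp

theorem memLp_mu_herm (k : Freq d) (j : Fin 3 × Fin 2) {n : ℕ} (hn : n ≠ 0) :
    MemLp (fun φ : Field d => herm j (len k.1 * φ k)) n (mu d 2) := by
  have hm : Measurable (fun φ : Field d => herm j (len k.1 * φ k)) :=
    (measurable_herm j).comp ((measurable_pi_apply k).const_mul _)
  refine (integrable_norm_rpow_iff (p := (n : ℝ≥0∞)) hm.aestronglyMeasurable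
      (by simpa using hn) (by simp)).mp ?_
  simpa using (integrable_mu_herm_pow k j n).1

end Gaussian

/-! ### The truncated field as a finite sum of Wick-ordered terms. -/

section Resonant

/-- The frequencies `1 ≤ |n| ≤ N`. -/
def ball (d N : ℕ) : Finset (Fin d → ℤ) :=
  {m ∈ Fintype.piFinset fun _ : Fin d => Finset.Icc (-(N : ℤ)) N | 1 ≤ len m ∧ len m ≤ N}

theorem abs_le_len (n : Fin d → ℤ) (i : Fin d) : |(n i : ℝ)| ≤ len n :=
  Real.abs_le_sqrt (Finset.single_le_sum (f := fun i => (n i : ℝ) ^ 2)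
    (fun _ _ => sq_nonneg _) (Finset.mem_univ i))

theorem one_le_len_iff {n : Fin d → ℤ} : 1 ≤ len n ↔ n ≠ 0 := by
  refine ⟨?_, fun h => one_le_len ⟨n, h⟩⟩
  rintro h rfl
  norm_num [len] at h

theorem mem_ball {N : ℕ} {n : Fin d → ℤ} : n ∈ ball d N ↔ n ≠ 0 ∧ len n ≤ N := by
  simp only [ball, Finset.mem_filter, Fintype.mem_piFinset, Finset.mem_Icc, one_le_len_iff,
    and_iff_right_iff_imp]
  rintro ⟨-, h⟩ i
  have := (abs_le_len n i).trans h
  rw [← abs_le]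
  exact_mod_cast this

theorem ball_mono {M N : ℕ} (h : M ≤ N) : ball d M ⊆ ball d N := fun n hn => by
  rw [mem_ball] at hn ⊢
  exact ⟨hn.1, hn.2.trans (by exact_mod_cast h)⟩

/-- The pairs `(l, m)` contributing to the `k`-th mode of the field truncated at `N`. -/
def resonant (N : ℕ) (k : Freq d) : Finset ((Fin d → ℤ) × (Fin d → ℤ)) :=
  {q ∈ (ball d N ×ˢ ball d N).image fun x => (x.1, x.2 - x.1) |
    k.1 ∈ ball d N ∧ k.1 - q.2 ∈ ball d N}

theorem mem_resonant {N : ℕ} {k : Freq d} {q : (Fin d → ℤ) × (Fin d → ℤ)} :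
    q ∈ resonant N k ↔ k.1 ∈ ball d N ∧ k.1 - q.2 ∈ ball d N ∧ q.1 + q.2 ∈ ball d N ∧
      q.1 ∈ ball d N := by
  simp only [resonant, Finset.mem_filter, Finset.mem_image, Finset.mem_product, Prod.exists]
  constructor
  · rintro ⟨⟨l, n, ⟨hl, hn⟩, rfl⟩, hk, h⟩
    refine ⟨hk, h, ?_, hl⟩
    simpa using hn
  · rintro ⟨hk, h1, h2, h3⟩
    refine ⟨⟨q.1, q.1 + q.2, ⟨h3, h2⟩, ?_⟩, hk, h1⟩
    ext <;> simp

theorem resonant_mono {M N : ℕ} (h : M ≤ N) (k : Freq d) : resonant M k ⊆ resonant N k :=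
  fun q hq => by
    rw [mem_resonant] at hq ⊢
    exact ⟨ball_mono h hq.1, ball_mono h hq.2.1, ball_mono h hq.2.2.1, ball_mono h hq.2.2.2⟩

/-- The Wick-ordered summand
`φ_{k-m} φ_{l+m} conj φ_l - E[φ_{l+m} conj φ_l] φ_k - E[φ_{k-m} conj φ_l] φ_k`. -/
def wickTerm (φ : Field d) (k : Freq d) (q : (Fin d → ℤ) × (Fin d → ℤ)) : ℂ :=
  cubicTerm φ k q - (if q.2 = 0 then 2 / (len q.1 : ℂ) ^ 2 * φ k else 0) -
    (if k.1 - q.2 = q.1 then 2 / (len q.1 : ℂ) ^ 2 * φ k else 0)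

theorem coef_coe (φ : Field d) (k : Freq d) : coef φ k.1 = φ k := by simp [coef, k.2]

theorem coef_proj (N : ℕ) (φ : Field d) (n : Fin d → ℤ) :
    coef (proj N φ) n = if n ∈ ball d N then coef φ n else 0 := by
  unfold coef proj
  by_cases h : n = 0
  · simp [h]
  · simp [h, mem_ball]

theorem cubicField_proj {N : ℕ} (φ : Field d) {k : Freq d} (hk : k.1 ∈ ball d N) :
    cubicField (proj N φ) k = ∑ q ∈ resonant N k, cubicTerm φ k q := by
  rw [cubicField, tsum_eq_sum (s := resonant N k)]
  · refine Finset.sum_congr rfl fun q hq => ?_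
    obtain ⟨-, h1, h2, h3⟩ := mem_resonant.mp hq
    simp [cubicTerm, coef_proj, h1, h2, h3]
  · intro q hq
    rw [mem_resonant] at hq
    by_cases h1 : k.1 - q.2 ∈ ball d N
    · by_cases h2 : q.1 + q.2 ∈ ball d N
      · have h3 : q.1 ∉ ball d N := fun h3 => hq ⟨hk, h1, h2, h3⟩
        simp [cubicTerm, coef_proj, h3]
      · simp [cubicTerm, coef_proj, h2]
    · simp [cubicTerm, coef_proj, h1]

theorem wickSum_eq (N : ℕ) : (wickSum d 2 N : ℂ) = ∑ n ∈ ball d N, 1 / (len n : ℂ) ^ 2 := by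
  rw [wickSum, Complex.ofReal_sum]
  refine Finset.sum_congr rfl fun n _ => ?_
  simp

theorem sum_resonant_left {N : ℕ} {k : Freq d} (hk : k.1 ∈ ball d N) (f : (Fin d → ℤ) → ℂ) :
    ∑ q ∈ resonant N k, (if q.2 = 0 then f q.1 else 0) = ∑ n ∈ ball d N, f n := by
  rw [← Finset.sum_filter]
  refine Finset.sum_nbij' (fun q => q.1) (fun n => (n, 0)) ?_ ?_ ?_ ?_ ?_
  · intro q hq
    exact (mem_resonant.mp (Finset.mem_filter.mp hq).1).2.2.2
  · intro n hn
    simp [mem_resonant, hk, hn]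
  · rintro ⟨l, m⟩ hq
    simpa using (Finset.mem_filter.mp hq).2.symm
  · intro n _; rfl
  · intro q _; rfl

theorem sum_resonant_right {N : ℕ} {k : Freq d} (hk : k.1 ∈ ball d N) (f : (Fin d → ℤ) → ℂ) :
    ∑ q ∈ resonant N k, (if k.1 - q.2 = q.1 then f q.1 else 0) = ∑ n ∈ ball d N, f n := by
  rw [← Finset.sum_filter]
  refine Finset.sum_nbij' (fun q => q.1) (fun n => (n, k.1 - n)) ?_ ?_ ?_ ?_ ?_
  · intro q hq
    exact (mem_resonant.mp (Finset.mem_filter.mp hq).1).2.2.2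
  · intro n hn
    simp [mem_resonant, hk, hn]
  · rintro ⟨l, m⟩ hq
    have := (Finset.mem_filter.mp hq).2
    simp only at this
    simp [← this]
  · intro n _; rfl
  · intro q _; rfl

/-- The coefficient $4$ is $2+2$: the lines $m=0$ and $k-m=l$ each run once through the ball and
subtract $2\sum|n|^{-2}\varphi_k$. The pair lying on both lines is corrected twice, as the Hermite
polynomial $z^2\bar z-4z$ requires. -/
theorem wickField_eq_sum (N : ℕ) (φ : Field d) (k : Freq d) :
    wickField 2 N φ k = ∑ q ∈ resonant N k, wickTerm φ k q := by
  by_cases hk : len k.1 ≤ N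
  · have hk' : k.1 ∈ ball d N := mem_ball.mpr ⟨k.2, hk⟩
    simp only [wickField, proj, hk, if_true, wickTerm, Finset.sum_sub_distrib]
    rw [sum_resonant_left hk' (fun n => 2 / (len n : ℂ) ^ 2 * φ k),
      sum_resonant_right hk' (fun n => 2 / (len n : ℂ) ^ 2 * φ k),
      cubicField_proj φ hk',
      wickSum_eq, ← Finset.sum_mul]
    have : ∑ n ∈ ball d N, 2 / (len n : ℂ) ^ 2 = 2 * ∑ n ∈ ball d N, 1 / (len n : ℂ) ^ 2 := by
      rw [Finset.mul_sum]
      exact Finset.sum_congr rfl fun n _ => by ring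
    rw [this]
    ring
  · have : resonant N k = ∅ := by
      refine Finset.eq_empty_of_forall_notMem fun q hq => hk ?_
      exact (mem_ball.mp (mem_resonant.mp hq).1).2
    simp [wickField, proj, hk, this]

end Resonant

/-! ### Wick monomials as products of Hermite polynomials. -/

section HermiteExpansion

/-- The multi-index of the Wick monomial `: φ_a φ_b conj φ_c :`. -/
def idx (a b c i : Freq d) : Fin 3 × Fin 2 :=
  ((if a = i then 1 else 0) + (if b = i then 1 else 0), if c = i then 1 else 0)

theorem idx_eq_zero {a b c i : Freq d} (ha : a ≠ i) (hb : b ≠ i) (hc : c ≠ i) :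
    idx a b c i = 0 := by
  simp [idx, ha, hb, hc]

/-- Modes other than $a,b,c$ contribute the factor $1$. The cases are the possible coincidences
among $a,b,c$; a contraction appears exactly when $c$ meets $a$ or $b$. -/
theorem prod_herm (φ : Field d) {a b c : Freq d} {I : Finset (Freq d)} (ha : a ∈ I) (hb : b ∈ I)
    (hc : c ∈ I) :
    ∏ i ∈ I, herm (idx a b c i) (len i.1 * φ i) = len a.1 * len b.1 * len c.1 *
      (φ a * φ b * conj (φ c) - (if b = c then 2 / (len c.1 : ℂ) ^ 2 * φ a else 0) -
        (if a = c then 2 / (len c.1 : ℂ) ^ 2 * φ b else 0)) := by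
  have hpos : ∀ i : Freq d, (len i.1 : ℂ) ≠ 0 := fun i => by
    exact_mod_cast (len_pos i).ne'
  have hsub : ({a, b, c} : Finset (Freq d)) ⊆ I := by
    intro i hi
    simp only [Finset.mem_insert, Finset.mem_singleton] at hi
    rcases hi with rfl | rfl | rfl <;> assumption
  rw [← Finset.prod_subset hsub]
  swap
  · intro i _ hi
    simp only [Finset.mem_insert, Finset.mem_singleton, not_or] at hi
    rw [idx_eq_zero (Ne.symm hi.1) (Ne.symm hi.2.1) (Ne.symm hi.2.2), herm_zero]
  have h10 : ∀ z, herm (1, 0) z = z := fun z => by simp [herm]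
  have h20 : ∀ z, herm (2, 0) z = z ^ 2 := fun z => by simp [herm]
  have h01 : ∀ z, herm (0, 1) z = conj z := fun z => by simp [herm]
  have h11 : ∀ z, herm (1, 1) z = z * conj z - 2 := fun z => by simp [herm]
  have h21 : ∀ z, herm (2, 1) z = z ^ 2 * conj z - 4 * z := fun z => by
    change z ^ 2 * conj z ^ 1 - 2 * ((2 : ℕ) : ℂ) * ((1 : ℕ) : ℂ) * z ^ 1 = _
    push_cast
    ring
  by_cases hab : a = b
  · subst hab
    by_cases hac : a = c
    · subst hac
      have := hpos a
      simp [idx, h21]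
      field_simp
      ring
    · have hca : ¬ c = a := fun h => hac h.symm
      simp [idx, hac, hca, h20, h01]
      ring
  · have hba : ¬ b = a := fun h => hab h.symm
    by_cases hac : a = c
    · subst hac
      have := hpos a
      simp [idx, hab, hba, h11, h10]
      field_simp
    · have hca : ¬ c = a := fun h => hac h.symm
      by_cases hbc : b = c
      · subst hbc
        have := hpos b
        simp [idx, hab, hba, h11, h10]
        field_simp
      · have hcb : ¬ c = b := fun h => hbc h.symm
        simp [idx, hab, hba, hac, hca, hbc, hcb, h10, h01]
        ring

theorem prod_chaosWeight_le {K : ℝ} (hK : 1 ≤ K) (a b c : Freq d) (I : Finset (Freq d)) :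
    ∏ i ∈ I, chaosWeight K (idx a b c i) ≤ K ^ 3 := by
  simp only [chaosWeight]
  rw [Finset.prod_ite, Finset.prod_const_one, one_mul, Finset.prod_const]
  refine pow_le_pow_right₀ hK (le_trans (Finset.card_le_card (t := {a, b, c}) fun i hi => ?_)
    Finset.card_le_three)
  by_contra h
  simp only [Finset.mem_insert, Finset.mem_singleton, not_or] at h
  exact (Finset.mem_filter.mp hi).2 (idx_eq_zero (Ne.symm h.1) (Ne.symm h.2.1) (Ne.symm h.2.2))

theorem eq_of_idx_eq_self_right {a b c a' b' c' : Freq d}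
    (h : idx a' b' c' c = idx a b c c) : c' = c := by
  by_contra hne
  have := congrArg Prod.snd h
  simp [idx, hne] at this

/-- A multi-index remembers its unconjugated frequencies only up to order, which is why a pattern
may occur twice. -/
theorem eq_or_eq_of_idx_eq_self_left {a b c a' b' c' : Freq d}
    (h : idx a' b' c' a = idx a b c a) : a' = a ∨ b' = a := by
  by_contra hne
  push Not at hne
  have := congrArg Prod.fst h
  by_cases hba : b = a
  · simp [idx, hne.1, hne.2, hba] at this
  · simp [idx, hne.1, hne.2, hba] at this

end HermiteExpansion

/-! ### Moment bounds for sums of Wick terms. -/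

section WickMoments

/-- The weight `|k-m|^{-s} |l+m|^{-s} |l|^{-s}` of the pair `q = (l, m)`. -/
def tripleWt (s : ℝ) (k : Freq d) (q : (Fin d → ℤ) × (Fin d → ℤ)) : ℝ≥0∞ :=
  wt s (k.1 - q.2) * wt s (q.1 + q.2) * wt s q.1

theorem wickTerm_eq {φ : Field d} {k a b c : Freq d} {q : (Fin d → ℤ) × (Fin d → ℤ)}
    (ha : k.1 - q.2 = a.1) (hb : q.1 + q.2 = b.1) (hc : q.1 = c.1) :
    wickTerm φ k q = φ a * φ b * conj (φ c) -
      (if b = c then 2 / (len c.1 : ℂ) ^ 2 * φ a else 0) -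
      (if a = c then 2 / (len c.1 : ℂ) ^ 2 * φ b else 0) := by
  have h1 : (if q.2 = 0 then 2 / (len q.1 : ℂ) ^ 2 * φ k else 0) =
      if b = c then 2 / (len c.1 : ℂ) ^ 2 * φ a else 0 := by
    have hiff : q.2 = 0 ↔ b = c := by
      rw [← Subtype.coe_inj, ← hb, ← hc]; simp
    by_cases h : q.2 = 0
    · rw [if_pos h, if_pos (hiff.mp h), ← hc,
        show a = k from Subtype.ext (by rw [← ha, h, sub_zero])]
    · rw [if_neg h, if_neg (mt hiff.mpr h)]
  have h2 : (if k.1 - q.2 = q.1 then 2 / (len q.1 : ℂ) ^ 2 * φ k else 0) =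
      if a = c then 2 / (len c.1 : ℂ) ^ 2 * φ b else 0 := by
    have hiff : k.1 - q.2 = q.1 ↔ a = c := by
      rw [← Subtype.coe_inj, ← ha, ← hc]
    by_cases h : k.1 - q.2 = q.1
    · rw [if_pos h, if_pos (hiff.mp h), ← hc,
        show b = k from Subtype.ext (by rw [← hb, ← h, sub_add_cancel])]
    · rw [if_neg h, if_neg (mt hiff.mpr h)]
  rw [wickTerm, h1, h2, cubicTerm, ha, hb, hc, coef_coe, coef_coe, coef_coe]

theorem wt_two_coe (k : Freq d) : wt 2 k.1 = ENNReal.ofReal ((len k.1)⁻¹ ^ 2) := by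
  rw [wt_coe, Real.rpow_neg (len_pos k).le, Real.rpow_two, inv_pow]

/-- All moments of a sum of Wick-ordered summands are controlled by the sum of the squares of
the amplitudes. -/
theorem wick_moment_le (p : ℕ) : ∃ C : ℝ≥0, ∀ {d : ℕ} (k : Freq d) (N : ℕ)
    (S : Finset ((Fin d → ℤ) × (Fin d → ℤ))), S ⊆ resonant N k →
    (∫⁻ φ, ‖∑ q ∈ S, wickTerm φ k q‖ₑ ^ (2 * (p + 1)) ∂mu d 2) ^ (1 / ((p + 1 : ℕ) : ℝ)) ≤
      C * ∑ q ∈ S, tripleWt 2 k q := by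
  have hG := gaussMoment_pos (3 * (2 * (p + 1)))
  have hM : 1 ≤ (12 : ℝ) ^ (2 * (p + 1)) * (1 + gaussMoment (3 * (2 * (p + 1)))) :=
    one_le_mul_of_one_le_of_one_le (one_le_pow₀ (by norm_num)) (by linarith)
  obtain ⟨K, hK, hchaos⟩ := chaos_moment_le p 2 (Fin 3 × Fin 2) hM
  refine ⟨(2 * K ^ 3).toNNReal, fun {d} k N S hS => ?_⟩
  -- The value at zero is a dummy: frequencies occurring in `S` lie in the ball and are nonzero.
  let toFreq : (Fin d → ℤ) → Freq d := fun n => if h : n ≠ 0 then ⟨n, h⟩ else k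
  have htoFreq : ∀ n, n ≠ 0 → (toFreq n).1 = n := fun n h => by simp [toFreq, h]
  let I : Finset (Freq d) := (ball d N).subtype (· ≠ 0)
  have hI : ∀ n ∈ ball d N, (toFreq n).1 = n ∧ toFreq n ∈ I := by
    intro n hn
    have h0 := htoFreq n (mem_ball.mp hn).1
    refine ⟨h0, ?_⟩
    rw [Finset.mem_subtype, h0]
    exact hn
  let A : (Fin d → ℤ) × (Fin d → ℤ) → Freq d := fun q => toFreq (k.1 - q.2)
  let B : (Fin d → ℤ) × (Fin d → ℤ) → Freq d := fun q => toFreq (q.1 + q.2)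
  let D : (Fin d → ℤ) × (Fin d → ℤ) → Freq d := fun q => toFreq q.1
  have hA : ∀ q ∈ S, (A q).1 = k.1 - q.2 ∧ A q ∈ I := fun q hq =>
    hI _ (mem_resonant.mp (hS hq)).2.1
  have hB : ∀ q ∈ S, (B q).1 = q.1 + q.2 ∧ B q ∈ I := fun q hq =>
    hI _ (mem_resonant.mp (hS hq)).2.2.1
  have hD : ∀ q ∈ S, (D q).1 = q.1 ∧ D q ∈ I := fun q hq =>
    hI _ (mem_resonant.mp (hS hq)).2.2.2
  -- The Hermite polynomials are evaluated at the normalised modes $|i|\varphi_i$; this coefficient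
  -- undoes the normalisation.
  let c : (Fin d → ℤ) × (Fin d → ℤ) → ℂ := fun q =>
    (((len (A q).1)⁻¹ * (len (B q).1)⁻¹ * (len (D q).1)⁻¹ : ℝ) : ℂ)
  have hpos : ∀ i : Freq d, (len i.1 : ℂ) ≠ 0 := fun i => by
    exact_mod_cast (len_pos i).ne'
  have hterm : ∀ (φ : Field d), ∀ q ∈ S, wickTerm φ k q =
      c q * ∏ i ∈ I, herm (idx (A q) (B q) (D q) i) (len i.1 * φ i) := by
    intro φ q hq
    rw [wickTerm_eq (hA q hq).1.symm (hB q hq).1.symm (hD q hq).1.symm,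
      prod_herm φ (hA q hq).2 (hB q hq).2 (hD q hq).2, ← mul_assoc]
    have : c q * (len (A q).1 * len (B q).1 * len (D q).1) = 1 := by
      have h1 := hpos (A q)
      have h2 := hpos (B q)
      have h3 := hpos (D q)
      simp only [c]
      push_cast
      field_simp
    rw [this, one_mul]
  -- The multi-index fixes $l$ and the unordered pair $\{k-m,\ l+m\}$. Exchanging the two members is
  -- the substitution $m\mapsto k-m-l$, so $L=2$.
  have hfib : ∀ t ∈ S, {t' ∈ S | ∀ i ∈ I, idx (A t') (B t') (D t') i =
      idx (A t) (B t) (D t) i}.card ≤ 2 := by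
    intro t ht
    refine le_trans (Finset.card_le_card (t := {t, (t.1, k.1 - t.2 - t.1)}) fun t' ht' => ?_)
      Finset.card_le_two
    obtain ⟨hS', hidx⟩ := Finset.mem_filter.mp ht'
    have e1 := congrArg Subtype.val (eq_of_idx_eq_self_right (hidx _ (hD t ht).2))
    rw [(hD t' hS').1, (hD t ht).1] at e1
    rw [Finset.mem_insert, Finset.mem_singleton]
    rcases eq_or_eq_of_idx_eq_self_left (hidx _ (hA t ht).2) with h | h
    · left
      have e2 := congrArg Subtype.val h
      rw [(hA t' hS').1, (hA t ht).1] at e2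
      exact Prod.ext e1 (sub_right_injective e2)
    · right
      have e2 := congrArg Subtype.val h
      rw [(hB t' hS').1, (hA t ht).1, e1] at e2
      exact Prod.ext e1 (by rw [← e2]; simp)
  obtain ⟨hLp, hmom⟩ := hchaos (Ω := Field d) (ι := Freq d) (μ := mu d 2)
    (X := fun i φ => φ i) (e := fun i j z => herm j (len i.1 * z))
    (fun i => measurable_pi_apply i)
    (ProbabilityTheory.iIndepFun_infinitePi (X := fun _ z => z) fun _ => measurable_id)
    (fun i j => (measurable_herm j).comp (measurable_const_mul _))
    (fun i z => herm_zero _) (fun i j hj => integral_mu_herm i hj)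
    (fun i j => memLp_mu_herm i j (by positivity))
    (fun i j => (integrable_mu_herm_pow i j _).2)
    I S c (fun q i => idx (A q) (B q) (D q) i) hfib
  have hsum : ∀ φ : Field d, ∑ q ∈ S, wickTerm φ k q =
      ∑ q ∈ S, c q * ∏ i ∈ I, herm (idx (A q) (B q) (D q) i) (len i.1 * φ i) :=
    fun φ => Finset.sum_congr rfl (hterm φ)
  simp only [hsum]
  rw [lintegral_enorm_pow_eq (by positivity) hLp]
  have hnn : ∀ j : Fin 3 × Fin 2, 0 ≤ chaosWeight K j := fun j => by
    unfold chaosWeight; split_ifs <;> linarith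
  have hle : (2 : ℕ) * ∑ t ∈ S, ‖c t‖ ^ 2 * ∏ i ∈ I, chaosWeight K (idx (A t) (B t) (D t) i) ≤
      2 * K ^ 3 * ∑ t ∈ S, ‖c t‖ ^ 2 := by
    rw [Nat.cast_two, mul_assoc, Finset.mul_sum (a := K ^ 3)]
    refine mul_le_mul_of_nonneg_left (Finset.sum_le_sum fun t _ => ?_) zero_le_two
    rw [mul_comm]
    exact mul_le_mul_of_nonneg_right (prod_chaosWeight_le hK _ _ _ _) (by positivity)
  have hnn' : 0 ≤ (2 : ℕ) * ∑ t ∈ S, ‖c t‖ ^ 2 *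
      ∏ i ∈ I, chaosWeight K (idx (A t) (B t) (D t) i) :=
    mul_nonneg (by positivity) (Finset.sum_nonneg fun t _ =>
      mul_nonneg (by positivity) (Finset.prod_nonneg fun i _ => hnn _))
  refine (ENNReal.rpow_le_rpow (ENNReal.ofReal_le_ofReal
    (hmom.trans (pow_le_pow_left₀ hnn' hle _))) (by positivity)).trans ?_
  rw [ENNReal.ofReal_pow (by positivity), ← ENNReal.rpow_natCast, ← ENNReal.rpow_mul,
    mul_one_div_cancel (by positivity), ENNReal.rpow_one, ENNReal.ofReal_mul (by positivity),
    ENNReal.ofReal_sum_of_nonneg fun _ _ => by positivity]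
  refine mul_le_mul' le_rfl (Finset.sum_le_sum fun q hq => le_of_eq ?_)
  rw [tripleWt, ← (hA q hq).1, ← (hB q hq).1, ← (hD q hq).1, wt_two_coe, wt_two_coe, wt_two_coe,
    ← ENNReal.ofReal_mul (by positivity), ← ENNReal.ofReal_mul (by positivity), Complex.norm_real,
    Real.norm_eq_abs, sq_abs, mul_pow, mul_pow]

end WickMoments

/-! ### Finiteness of the weighted sums and vanishing of their tails. -/

section Sums

theorem tsum_freq_tripleWt_ne_top (hd : 0 < d) {β : ℝ} (hβ : β < 0) :
    ∑' k : Freq d, ENNReal.ofReal (len k.1 ^ (2 * β)) * ∑' q, tripleWt d k q ≠ ∞ := by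
  -- The minimum with $d$ meets the restriction $\sigma\le d$ of the resonant sum; as $|k|\ge1$,
  -- lowering the decay rate only enlarges the weight.
  set σ : ℝ := min (-(2 * β)) d with hσdef
  have hd' : (0 : ℝ) < d := by exact_mod_cast hd
  have hσ : 0 < σ := lt_min (by linarith) hd'
  have H := tsum_resonant_ne_top hσ (min_le_right (-(2 * β)) (d : ℝ))
  rw [ENNReal.tsum_prod'] at H
  refine ne_top_of_le_ne_top H ?_
  refine le_trans (ENNReal.tsum_le_tsum fun k => ?_)
    (ENNReal.tsum_comp_le_tsum_of_injective
      (Subtype.val_injective (p := fun k : Fin d → ℤ => k ≠ 0)) _)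
  dsimp only
  rw [ENNReal.tsum_mul_left]
  refine mul_le_mul' ?_ le_rfl
  rw [wt_coe]
  refine ENNReal.ofReal_le_ofReal (Real.rpow_le_rpow_of_exponent_le (one_le_len k) ?_)
  have := min_le_left (-(2 * β)) (d : ℝ)
  linarith

theorem tsum_tripleWt_ne_top (hd : 0 < d) (k : Freq d) : ∑' q, tripleWt d k q ≠ ∞ := by
  intro h
  have H := ENNReal.ne_top_of_tsum_ne_top (tsum_freq_tripleWt_ne_top hd (β := -1) (by norm_num)) k
  rw [h, ENNReal.mul_top] at H
  · exact H rfl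
  · have := Real.rpow_pos_of_pos (len_pos k) (2 * -1)
    exact (ENNReal.ofReal_pos.mpr this).ne'

/-- Dominated convergence for counting measure. -/
theorem tendsto_tsum_ite_zero {X : Type*} {f : X → ℝ≥0∞} (hf : ∑' x, f x ≠ ∞)
    {P : ℕ → X → Prop} [∀ N x, Decidable (P N x)] (hP : ∀ x, ∀ᶠ N in atTop, P N x) :
    Tendsto (fun N => ∑' x, if P N x then 0 else f x) atTop (𝓝 0) := by
  let _ : MeasurableSpace X := ⊤
  simp only [← lintegral_count] at hf ⊢
  have := tendsto_lintegral_of_dominated_convergence (μ := Measure.count)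
    (F := fun N x => if P N x then 0 else f x) (f := fun _ => 0) f
    (fun N => measurable_from_top)
    (fun N => Eventually.of_forall fun x => by
      dsimp only
      split_ifs
      · exact zero_le
      · exact le_rfl) hf
    (Eventually.of_forall fun x => by
      refine tendsto_const_nhds.congr' ?_
      filter_upwards [hP x] with N hN
      rw [if_pos hN])
  simpa using this

end Sums

/-! ### Dimension one: absolute convergence and moments. -/

section DimensionOne

theorem mul_mul_pow_le (x y z : ℝ≥0∞) (n : ℕ) :
    (x * y * z) ^ n ≤ x ^ (3 * n) + y ^ (3 * n) + z ^ (3 * n) := by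
  set m := max x (max y z) with hm
  have h : x * y * z ≤ m ^ 3 := by
    rw [pow_succ, pow_two]
    exact mul_le_mul' (mul_le_mul' (le_max_left _ _) ((le_max_left _ _).trans (le_max_right _ _)))
      ((le_max_right _ _).trans (le_max_right _ _))
  refine (pow_le_pow_left₀ zero_le h n).trans ?_
  rw [← pow_mul]
  rcases max_choice x (max y z) with h' | h' <;> rw [hm, h']
  · exact le_self_add.trans le_self_add
  · rcases max_choice y z with h'' | h'' <;> rw [h'']
    · exact le_add_self.trans le_self_add
    · exact le_add_self

theorem enorm_eq_wt_mul (φ : Field d) (a : Freq d) :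
    ‖φ a‖ₑ = wt 1 a.1 * ‖(len a.1 : ℂ) * φ a‖ₑ := by
  have h := len_pos a
  rw [wt_coe, ← ofReal_norm, ← ofReal_norm, ← ENNReal.ofReal_mul (by positivity), norm_mul,
    Complex.norm_real, Real.norm_of_nonneg h.le, Real.rpow_neg_one, inv_mul_cancel_left₀ h.ne']

theorem measurable_cubicTerm (k : Freq d) (q : (Fin d → ℤ) × (Fin d → ℤ)) :
    Measurable fun φ : Field d => cubicTerm φ k q := by
  have hc : ∀ n : Fin d → ℤ, Measurable fun φ : Field d => coef φ n := fun n => by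
    unfold coef
    split_ifs
    · exact measurable_pi_apply _
    · exact measurable_const
  exact ((hc _).mul (hc _)).mul (Complex.continuous_conj.measurable.comp (hc _))

/-- No independence is used: a product of three normalised modes is bounded by the cube of the
largest, hence the constant $3$ and the moment of order $3n$. -/
theorem cubicTerm_moment_le {n : ℕ} (hn : n ≠ 0) (k : Freq d) (q : (Fin d → ℤ) × (Fin d → ℤ)) :
    (∫⁻ φ, ‖cubicTerm φ k q‖ₑ ^ (n : ℝ) ∂mu d 2) ^ (1 / (n : ℝ)) ≤
      ENNReal.ofReal (3 * gaussMoment (3 * n)) ^ (1 / (n : ℝ)) * tripleWt 1 k q := by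
  have hn' : (0 : ℝ) < n := by exact_mod_cast Nat.pos_of_ne_zero hn
  by_cases h0 : k.1 - q.2 = 0 ∨ q.1 + q.2 = 0 ∨ q.1 = 0
  · have : ∀ φ : Field d, cubicTerm φ k q = 0 := fun φ => by
      have hz : coef φ 0 = 0 := by simp [coef]
      rcases h0 with h | h | h <;> simp [cubicTerm, h, hz]
    simp only [this]
    simp [hn', hn]
  push Not at h0
  obtain ⟨h1, h2, h3⟩ := h0
  set a : Freq d := ⟨_, h1⟩
  set b : Freq d := ⟨_, h2⟩
  set c : Freq d := ⟨_, h3⟩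
  have hpt : ∀ φ : Field d, ‖cubicTerm φ k q‖ₑ ^ (n : ℝ) ≤ tripleWt 1 k q ^ n *
      (‖(len a.1 : ℂ) * φ a‖ₑ ^ (3 * n) + ‖(len b.1 : ℂ) * φ b‖ₑ ^ (3 * n) +
        ‖(len c.1 : ℂ) * φ c‖ₑ ^ (3 * n)) := by
    intro φ
    have e : ‖cubicTerm φ k q‖ₑ = tripleWt 1 k q * (‖(len a.1 : ℂ) * φ a‖ₑ *
        ‖(len b.1 : ℂ) * φ b‖ₑ * ‖(len c.1 : ℂ) * φ c‖ₑ) := by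
      have : cubicTerm φ k q = φ a * φ b * conj (φ c) := by
        rw [cubicTerm, ← coef_coe φ a, ← coef_coe φ b, ← coef_coe φ c]
      rw [this, enorm_mul, enorm_mul, RCLike.enorm_conj, enorm_eq_wt_mul φ a, enorm_eq_wt_mul φ b,
        enorm_eq_wt_mul φ c, tripleWt]
      ring
    rw [ENNReal.rpow_natCast, e, mul_pow]
    exact mul_le_mul' le_rfl (mul_mul_pow_le _ _ _ n)
  have hm : ∀ i : Freq d, Measurable fun φ : Field d => ‖(len i.1 : ℂ) * φ i‖ₑ ^ (3 * n) := fun i =>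
    ((measurable_pi_apply i).const_mul _).enorm.pow_const _
  have hab : Measurable fun φ : Field d =>
      ‖(len a.1 : ℂ) * φ a‖ₑ ^ (3 * n) + ‖(len b.1 : ℂ) * φ b‖ₑ ^ (3 * n) := (hm a).add (hm b)
  have habc : Measurable fun φ : Field d => ‖(len a.1 : ℂ) * φ a‖ₑ ^ (3 * n) +
      ‖(len b.1 : ℂ) * φ b‖ₑ ^ (3 * n) + ‖(len c.1 : ℂ) * φ c‖ₑ ^ (3 * n) := hab.add (hm c)
  have hG := (gaussMoment_pos (3 * n)).le
  have hint : ∫⁻ φ, ‖cubicTerm φ k q‖ₑ ^ (n : ℝ) ∂mu d 2 ≤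
      tripleWt 1 k q ^ n * ENNReal.ofReal (3 * gaussMoment (3 * n)) := by
    refine (lintegral_mono hpt).trans_eq ?_
    rw [lintegral_const_mul _ habc, lintegral_add_left hab, lintegral_add_left (hm a),
      lintegral_mu_norm_pow,
      lintegral_mu_norm_pow, lintegral_mu_norm_pow, ← ENNReal.ofReal_add hG hG,
      ← ENNReal.ofReal_add (by positivity) hG]
    congr 2
    ring
  refine (ENNReal.rpow_le_rpow hint (by positivity)).trans_eq ?_
  rw [ENNReal.mul_rpow_of_nonneg _ _ (by positivity), ← ENNReal.rpow_natCast, ← ENNReal.rpow_mul,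
    mul_one_div_cancel hn'.ne', ENNReal.rpow_one, mul_comm]

theorem ae_summable_cubicTerm : ∀ᵐ φ ∂mu 1 2, ∀ k, Summable (cubicTerm φ k) := by
  rw [ae_all_iff]
  intro k
  have hfin : ∫⁻ φ, ∑' q, ‖cubicTerm φ k q‖ₑ ∂mu 1 2 ≠ ∞ := by
    rw [lintegral_tsum fun q => (measurable_cubicTerm k q).enorm.aemeasurable]
    refine ne_top_of_le_ne_top (b := ∑' q, ENNReal.ofReal (3 * gaussMoment (3 * 1)) *
      tripleWt 1 k q) ?_ (ENNReal.tsum_le_tsum fun q => ?_)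
    · rw [ENNReal.tsum_mul_left]
      have := tsum_tripleWt_ne_top one_pos k
      rw [Nat.cast_one] at this
      exact ENNReal.mul_ne_top ENNReal.ofReal_ne_top this
    · simpa using cubicTerm_moment_le one_ne_zero k q
  have hae := ae_lt_top (Measurable.tsum fun q => (measurable_cubicTerm k q).enorm) hfin
  filter_upwards [hae] with φ hφ
  exact (tsum_enorm_ne_top_iff_summable_norm.mp hφ.ne).of_norm

theorem measurable_cubicField (k : Freq d) : Measurable fun φ : Field d => cubicField φ k :=
  Measurable.tsum fun q => measurable_cubicTerm k q

theorem memLpSobolev_cubicField {β p : ℝ} (hβ : β < 0) (hp : 1 ≤ p) :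
    MemLpSobolev (mu 1 2) β p cubicField := by
  refine ⟨fun k => (measurable_cubicField k).aemeasurable, ?_⟩
  obtain ⟨r, hr⟩ := exists_nat_ge p
  have hr0 : (0 : ℝ) < r := by linarith
  have hrn : r ≠ 0 := by rintro rfl; simp at hr0
  refine (lpSobolevNorm_le (q := r) hp (by linarith)
    fun k => (measurable_cubicField k).aemeasurable).trans_lt ?_
  refine ENNReal.rpow_lt_top_of_nonneg (by positivity) ?_
  set C : ℝ≥0∞ := ENNReal.ofReal (3 * gaussMoment (3 * (2 * r))) ^ (1 / ((2 * r : ℕ) : ℝ)) with hC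
  have hCtop : C ≠ ∞ := ENNReal.rpow_ne_top_of_nonneg (by positivity) ENNReal.ofReal_ne_top
  set s : Freq 1 → ℝ≥0∞ := fun k => ∑' q, tripleWt 1 k q with hs
  have hmom : ∀ k : Freq 1, (∫⁻ φ, ‖cubicField φ k‖ₑ ^ (2 * r) ∂mu 1 2) ^ (1 / (r : ℝ)) ≤
      (C * s k) ^ 2 := by
    intro k
    have h2r : (1 : ℝ) ≤ ((2 * r : ℕ) : ℝ) := by
      exact_mod_cast Nat.one_le_iff_ne_zero.mpr (by positivity)
    have hmink := lintegral_tsum_rpow_le (μ := mu 1 2)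
      (fun q => (measurable_cubicTerm k q).enorm.aemeasurable) h2r
    have hbd : (∫⁻ φ, ‖cubicField φ k‖ₑ ^ (2 * r) ∂mu 1 2) ^ (1 / ((2 * r : ℕ) : ℝ)) ≤ C * s k := by
      rw [hs, ← ENNReal.tsum_mul_left]
      refine le_trans (ENNReal.rpow_le_rpow (lintegral_mono fun φ => ?_) (by positivity))
        (hmink.trans (ENNReal.tsum_le_tsum fun q => cubicTerm_moment_le (by positivity) k q))
      rw [ENNReal.rpow_natCast]
      exact pow_le_pow_left₀ zero_le enorm_tsum_le_tsum_enorm _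
    refine le_trans (le_of_eq ?_) (pow_le_pow_left₀ zero_le hbd 2)
    rw [← ENNReal.rpow_natCast, ← ENNReal.rpow_mul]
    congr 1
    push_cast
    field_simp
  -- The triangle inequality yields $s_k^2$ rather than $s_k$. The weight $|k|^{2\beta}$ is
  -- therefore split into two factors $|k|^{\beta}$, and $\sum x_k^2\le(\sum x_k)^2$ is applied;
  -- negativity of $\beta/2$ is enough.
  set T : ℝ≥0∞ := ∑' k : Freq 1, ENNReal.ofReal (len k.1 ^ (2 * (β / 2))) * s k with hT
  have hTtop : T ≠ ∞ := by
    have := tsum_freq_tripleWt_ne_top one_pos (β := β / 2) (by linarith)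
    rwa [Nat.cast_one] at this
  have hbound : ∑' k : Freq 1, ENNReal.ofReal (len k.1 ^ (2 * β)) *
      (∫⁻ φ, ‖cubicField φ k‖ₑ ^ (2 * r) ∂mu 1 2) ^ (1 / (r : ℝ)) ≤ C ^ 2 * (T * T) := by
    rw [hT, ← ENNReal.tsum_mul_left, ← ENNReal.tsum_mul_left]
    refine ENNReal.tsum_le_tsum fun k => ?_
    rw [← hT]
    have hsq : ENNReal.ofReal (len k.1 ^ (2 * β)) =
        ENNReal.ofReal (len k.1 ^ (2 * (β / 2))) * ENNReal.ofReal (len k.1 ^ (2 * (β / 2))) := by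
      have := len_pos k
      rw [← ENNReal.ofReal_mul (by positivity), ← Real.rpow_add this]
      congr 2
      ring
    calc _ ≤ ENNReal.ofReal (len k.1 ^ (2 * β)) * (C * s k) ^ 2 := mul_le_mul' le_rfl (hmom k)
      _ = C ^ 2 * ((ENNReal.ofReal (len k.1 ^ (2 * (β / 2))) * s k) *
            (ENNReal.ofReal (len k.1 ^ (2 * (β / 2))) * s k)) := by rw [hsq]; ring
      _ ≤ _ := mul_le_mul' le_rfl (mul_le_mul' (ENNReal.le_tsum k) le_rfl)
  exact ne_top_of_le_ne_top (ENNReal.mul_ne_top (ENNReal.pow_ne_top hCtop)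
    (ENNReal.mul_ne_top hTtop hTtop)) hbound

end DimensionOne

/-! ### Limits of Cauchy sequences and Fatou's lemma. -/

section Limit

variable {Ω : Type*} [MeasurableSpace Ω] {μ : Measure Ω}

/-- A Cauchy sequence in `L²` converges almost everywhere along a subsequence. -/
theorem exists_ae_limit_of_cauchy {f : ℕ → Ω → ℂ} (hf : ∀ N, Measurable (f N))
    (hfin : ∀ N, ∫⁻ ω, ‖f N ω‖ₑ ^ 2 ∂μ ≠ ∞) {δ : ℕ → ℝ≥0∞} (hδ : Tendsto δ atTop (𝓝 0))
    (hc : ∀ M N, M ≤ N → ∫⁻ ω, ‖f M ω - f N ω‖ₑ ^ 2 ∂μ ≤ δ M) :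
    ∃ g : Ω → ℂ, AEMeasurable g μ ∧ ∃ ns : ℕ → ℕ, StrictMono ns ∧
      ∀ᵐ ω ∂μ, Tendsto (fun i => f (ns i) ω) atTop (𝓝 (g ω)) := by
  have hnorm : ∀ h : Ω → ℂ, eLpNorm h 2 μ = (∫⁻ ω, ‖h ω‖ₑ ^ 2 ∂μ) ^ (1 / 2 : ℝ) := fun h => by
    rw [eLpNorm_eq_lintegral_rpow_enorm_toReal (by norm_num) (by norm_num)]
    simp
  have hLp : ∀ N, MemLp (f N) 2 μ := fun N => ⟨(hf N).aestronglyMeasurable, by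
    rw [hnorm]
    exact ENNReal.rpow_lt_top_of_nonneg (by positivity) (hfin N)⟩
  let F : ℕ → Lp ℂ 2 μ := fun N => (hLp N).toLp (f N)
  have hδ' : Tendsto (fun N => δ N ^ (1 / 2 : ℝ)) atTop (𝓝 0) := by
    have := hδ.ennrpow_const (1 / 2 : ℝ)
    simpa using this
  have hed : ∀ M N, M ≤ N → edist (F M) (F N) ≤ δ M ^ (1 / 2 : ℝ) := fun M N hMN => by
    rw [Lp.edist_toLp_toLp, hnorm]
    exact ENNReal.rpow_le_rpow (hc M N hMN) (by positivity)
  have hcau : CauchySeq F := by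
    refine EMetric.cauchySeq_iff'.mpr fun ε hε => ?_
    obtain ⟨M, hM⟩ := (hδ'.eventually (gt_mem_nhds hε)).exists
    refine ⟨M, fun N hN => ?_⟩
    rw [edist_comm]
    exact (hed M N hN).trans_lt hM
  obtain ⟨g, hg⟩ := cauchySeq_tendsto_of_complete hcau
  obtain ⟨ns, hns, hae⟩ := (tendstoInMeasure_of_tendsto_Lp hg).exists_seq_tendsto_ae
  refine ⟨g, (Lp.aestronglyMeasurable g).aemeasurable, ns, hns, ?_⟩
  have hcoe : ∀ᵐ ω ∂μ, ∀ N, F N ω = f N ω := ae_all_iff.mpr fun N => (hLp N).coeFn_toLp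
  filter_upwards [hae, hcoe] with ω h1 h2
  simpa only [h2] using h1

/-- Fatou along the almost everywhere convergent subsequence. The exponent $n$ is arbitrary, so a
limit obtained in $L^2$ inherits all moment bounds; `h = 0` bounds the limit itself and `h = f M`
the error. -/
theorem lintegral_enorm_sub_limit_le {f : ℕ → Ω → ℂ} (hf : ∀ N, Measurable (f N)) {g h : Ω → ℂ}
    (hh : Measurable h) {ns : ℕ → ℕ} (hns : StrictMono ns)
    (hlim : ∀ᵐ ω ∂μ, Tendsto (fun i => f (ns i) ω) atTop (𝓝 (g ω))) {n M : ℕ} {A : ℝ≥0∞}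
    (hA : ∀ N, M ≤ N → ∫⁻ ω, ‖h ω - f N ω‖ₑ ^ n ∂μ ≤ A) :
    ∫⁻ ω, ‖h ω - g ω‖ₑ ^ n ∂μ ≤ A := by
  calc ∫⁻ ω, ‖h ω - g ω‖ₑ ^ n ∂μ
      = ∫⁻ ω, liminf (fun i => ‖h ω - f (ns i) ω‖ₑ ^ n) atTop ∂μ := by
        refine lintegral_congr_ae ?_
        filter_upwards [hlim] with ω hω
        refine (Tendsto.liminf_eq ?_).symm
        exact (ENNReal.continuous_pow n).tendsto _ |>.comp (tendsto_const_nhds.sub hω).enorm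
    _ ≤ liminf (fun i => ∫⁻ ω, ‖h ω - f (ns i) ω‖ₑ ^ n ∂μ) atTop :=
        lintegral_liminf_le fun i => ((hh.sub (hf _)).enorm.pow_const n)
    _ ≤ A := by
        refine liminf_le_of_frequently_le' (Eventually.frequently ?_)
        filter_upwards [eventually_ge_atTop M] with i hi
        exact hA _ (hi.trans (hns.id_le i))

end Limit

/-! ### Dimension two: uniform bounds and the renormalised limit. -/

section DimensionTwo

theorem measurable_wickTerm (k : Freq d) (q : (Fin d → ℤ) × (Fin d → ℤ)) :
    Measurable fun φ : Field d => wickTerm φ k q := by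
  have hk : ∀ (P : Prop) [Decidable P] (c : ℂ),
      Measurable fun φ : Field d => if P then c * φ k else 0 := fun P _ c => by
    split_ifs
    · have hm : Measurable fun φ : Field d => φ k := measurable_pi_apply k
      exact hm.const_mul c
    · exact measurable_const
  exact ((measurable_cubicTerm k q).sub (hk _ _)).sub (hk _ _)

theorem measurable_wickField (N : ℕ) (k : Freq d) :
    Measurable fun φ : Field d => wickField 2 N φ k := by
  simp only [wickField_eq_sum]
  exact Finset.measurable_fun_sum _ fun q _ => measurable_wickTerm k q

/-- The total amplitude of the pairs not contributing at cutoff `N`. -/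
def tailWt (N : ℕ) (k : Freq d) : ℝ≥0∞ :=
  ∑' q, if q ∈ resonant N k then 0 else tripleWt 2 k q

theorem eventually_mem_resonant (k : Freq d) {q : (Fin d → ℤ) × (Fin d → ℤ)}
    (hq : tripleWt 2 k q ≠ 0) : ∀ᶠ N in atTop, q ∈ resonant N k := by
  have hball : ∀ n : Fin d → ℤ, n ≠ 0 → ∀ᶠ N in atTop, n ∈ ball d N := fun n hn => by
    obtain ⟨M, hM⟩ := exists_nat_ge (len n)
    filter_upwards [eventually_ge_atTop M] with N hN
    exact mem_ball.mpr ⟨hn, hM.trans (by exact_mod_cast hN)⟩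
  have h1 : k.1 - q.2 ≠ 0 := fun h => hq (by simp [tripleWt, wt, h])
  have h2 : q.1 + q.2 ≠ 0 := fun h => hq (by simp [tripleWt, wt, h])
  have h3 : q.1 ≠ 0 := fun h => hq (by simp [tripleWt, wt, h])
  filter_upwards [hball _ k.2, hball _ h1, hball _ h2, hball _ h3] with N a b c e
  exact mem_resonant.mpr ⟨a, b, c, e⟩

theorem tendsto_tsum_tailWt {w : Freq d → ℝ≥0∞}
    (hw : ∑' k : Freq d, w k * ∑' q, tripleWt 2 k q ≠ ∞) :
    Tendsto (fun N => ∑' k : Freq d, w k * tailWt N k) atTop (𝓝 0) := by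
  classical
  simp only [← ENNReal.tsum_mul_left] at hw
  rw [← ENNReal.tsum_prod (f := fun k q => w k * tripleWt 2 k q)] at hw
  -- Pairs of weight zero may never become resonant, so they are counted as exhausted from the
  -- start.
  have H := tendsto_tsum_ite_zero hw
    (P := fun N x => x.2 ∈ resonant N x.1 ∨ tripleWt 2 x.1 x.2 = 0) (fun x => by
      by_cases h : tripleWt 2 x.1 x.2 = 0
      · exact Eventually.of_forall fun N => Or.inr h
      · exact (eventually_mem_resonant x.1 h).mono fun N hN => Or.inl hN)
  refine H.congr fun N => ?_
  rw [ENNReal.tsum_prod']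
  refine tsum_congr fun k => ?_
  rw [tailWt, ← ENNReal.tsum_mul_left]
  refine tsum_congr fun q => ?_
  by_cases h1 : q ∈ resonant N k
  · simp [h1]
  · by_cases h2 : tripleWt 2 k q = 0 <;> simp [h1, h2]

/-- The weighted statement with the weight concentrated on a single mode. -/
theorem tendsto_tailWt {k : Freq d} (hk : ∑' q, tripleWt 2 k q ≠ ∞) :
    Tendsto (fun N => tailWt N k) atTop (𝓝 0) := by
  classical
  have hsum : ∀ f : Freq d → ℝ≥0∞, ∑' k', (if k' = k then 1 else 0) * f k' = f k := fun f => by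
    rw [tsum_eq_single k fun k' hk' => by simp [hk']]
    simp
  have := tendsto_tsum_tailWt (w := fun k' => if k' = k then 1 else 0) (by rwa [hsum])
  simpa only [hsum] using this

/-- The difference of two truncations is again a sum of Wick terms, over the pairs resonant at $N$
but not at $M$, so the same moment bound covers it with the tail on the right. -/
theorem wickField_moment_le (p : ℕ) : ∃ C : ℝ≥0, ∀ {d : ℕ} (k : Freq d) (N : ℕ),
    (∫⁻ φ, ‖wickField 2 N φ k‖ₑ ^ (2 * (p + 1)) ∂mu d 2 ≤
        (C * ∑' q, tripleWt 2 k q) ^ (p + 1)) ∧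
      ∀ M ≤ N, ∫⁻ φ, ‖wickField 2 M φ k - wickField 2 N φ k‖ₑ ^ (2 * (p + 1)) ∂mu d 2 ≤
        (C * tailWt M k) ^ (p + 1) := by
  obtain ⟨C, hC⟩ := wick_moment_le p
  have root : ∀ x y : ℝ≥0∞, x ^ (1 / ((p + 1 : ℕ) : ℝ)) ≤ y → x ≤ y ^ (p + 1) := fun x y h => by
    rwa [one_div, ENNReal.rpow_inv_le_iff (by positivity), ENNReal.rpow_natCast] at h
  refine ⟨C, fun {d} k N => ⟨?_, fun M hM => ?_⟩⟩
  · refine root _ _ ?_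
    simp only [wickField_eq_sum]
    exact (hC k N _ subset_rfl).trans (mul_le_mul' le_rfl (ENNReal.sum_le_tsum _))
  · refine root _ _ ?_
    have hdiff : ∀ φ : Field d, ‖wickField 2 M φ k - wickField 2 N φ k‖ₑ =
        ‖∑ q ∈ resonant N k \ resonant M k, wickTerm φ k q‖ₑ := fun φ => by
      rw [wickField_eq_sum, wickField_eq_sum, ← Finset.sum_sdiff (resonant_mono hM k),
        sub_add_cancel_right, enorm_neg]
    simp only [hdiff]
    refine (hC k N _ Finset.sdiff_subset).trans (mul_le_mul' le_rfl ?_)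
    refine le_trans (le_of_eq ?_) (ENNReal.sum_le_tsum (resonant N k \ resonant M k))
    exact Finset.sum_congr rfl fun q hq => by rw [if_neg (Finset.mem_sdiff.mp hq).2]

theorem exists_wick_limit (hd : ∀ k : Freq d, ∑' q, tripleWt 2 k q ≠ ∞) :
    ∃ W : Field d → Field d, (∀ k, AEMeasurable (fun φ => W φ k) (mu d 2)) ∧
      ∀ k, ∃ ns : ℕ → ℕ, StrictMono ns ∧
        ∀ᵐ φ ∂mu d 2, Tendsto (fun i => wickField 2 (ns i) φ k) atTop (𝓝 (W φ k)) := by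
  -- Index $0$ means second moments, which suffice to construct the limit of each mode; the
  -- subsequence may depend on $k$.
  obtain ⟨C, hC⟩ := wickField_moment_le 0
  have H : ∀ k : Freq d, ∃ g : Field d → ℂ, AEMeasurable g (mu d 2) ∧
      ∃ ns : ℕ → ℕ, StrictMono ns ∧
        ∀ᵐ φ ∂mu d 2, Tendsto (fun i => wickField 2 (ns i) φ k) atTop (𝓝 (g φ)) := by
    intro k
    refine exists_ae_limit_of_cauchy (δ := fun M => C * tailWt M k)
      (fun N => measurable_wickField N k) (fun N => ?_) ?_ fun M N hMN => ?_
    · refine ne_top_of_le_ne_top ?_ (hC k N).1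
      exact ENNReal.pow_ne_top (ENNReal.mul_ne_top ENNReal.coe_ne_top (hd k))
    · have := ENNReal.Tendsto.const_mul (a := C) (tendsto_tailWt (hd k))
        (Or.inr ENNReal.coe_ne_top)
      simpa using this
    · simpa using (hC k N).2 M hMN
  choose g hg hlim using H
  exact ⟨fun φ k => g k φ, hg, hlim⟩

theorem wick_limit_dimension_two :
    ∃ W : Field 2 → Field 2, ∀ β p : ℝ, β < 0 → 1 ≤ p →
      (∃ C : ℝ≥0, ∀ N : ℕ, MemLpSobolev (mu 2 2) β p (wickField 2 N) ∧
        lpSobolevNorm (mu 2 2) β p (wickField 2 N) ≤ C) ∧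
      MemLpSobolev (mu 2 2) β p W ∧
      Tendsto (fun N : ℕ => lpSobolevNorm (mu 2 2) β p
        (fun φ k => wickField 2 N φ k - W φ k)) atTop (𝓝 0) := by
  have hfin : ∀ k : Freq 2, ∑' q, tripleWt 2 k q ≠ ∞ := fun k => by
    have := tsum_tripleWt_ne_top two_pos k
    rwa [Nat.cast_two] at this
  obtain ⟨W, hWm, hWlim⟩ := exists_wick_limit hfin
  refine ⟨W, fun β p hβ hp => ?_⟩
  obtain ⟨r, hr⟩ := exists_nat_ge p
  have hpr : p ≤ 2 * ((r + 1 : ℕ) : ℝ) := by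
    push_cast
    linarith
  obtain ⟨C, hC⟩ := wickField_moment_le r
  have hsum : ∑' k : Freq 2, ENNReal.ofReal (len k.1 ^ (2 * β)) * ∑' q, tripleWt 2 k q ≠ ∞ := by
    have := tsum_freq_tripleWt_ne_top two_pos hβ
    rwa [Nat.cast_two] at this
  -- Shared by three bounds: the truncated fields, the limit, and their difference, where `A` is the
  -- full weight in the first two cases and the tail in the last.
  have hnorm : ∀ {F : Field 2 → Field 2} {A : Freq 2 → ℝ≥0∞},
      (∀ k, AEMeasurable (fun φ => F φ k) (mu 2 2)) →
      (∀ k, ∫⁻ φ, ‖F φ k‖ₑ ^ (2 * (r + 1)) ∂mu 2 2 ≤ (C * A k) ^ (r + 1)) →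
      lpSobolevNorm (mu 2 2) β p F ≤
        (C * ∑' k : Freq 2, ENNReal.ofReal (len k.1 ^ (2 * β)) * A k) ^ (1 / 2 : ℝ) := by
    intro F A hF hA
    refine (lpSobolevNorm_le hp hpr hF).trans (ENNReal.rpow_le_rpow ?_ (by positivity))
    rw [← ENNReal.tsum_mul_left]
    refine ENNReal.tsum_le_tsum fun k => ?_
    rw [mul_left_comm]
    refine mul_le_mul' le_rfl ?_
    rw [one_div, ENNReal.rpow_inv_le_iff (by positivity), ENNReal.rpow_natCast]
    exact hA k
  set R : ℝ≥0∞ := (C * ∑' k : Freq 2, ENNReal.ofReal (len k.1 ^ (2 * β)) *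
    ∑' q, tripleWt 2 k q) ^ (1 / 2 : ℝ) with hR
  have hRtop : R < ∞ := ENNReal.rpow_lt_top_of_nonneg (by positivity)
    (ENNReal.mul_ne_top ENNReal.coe_ne_top hsum)
  have hN : ∀ N, lpSobolevNorm (mu 2 2) β p (wickField 2 N) ≤ R := fun N =>
    hnorm (fun k => (measurable_wickField N k).aemeasurable) fun k => (hC k N).1
  have hW : lpSobolevNorm (mu 2 2) β p W ≤ R := by
    refine hnorm hWm fun k => ?_
    obtain ⟨ns, hns, hlim⟩ := hWlim k
    have := lintegral_enorm_sub_limit_le (fun N => measurable_wickField N k)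
      (measurable_const (a := (0 : ℂ))) hns hlim (n := 2 * (r + 1)) (M := 0)
      (A := (C * ∑' q, tripleWt 2 k q) ^ (r + 1)) fun N _ => by simpa using (hC k N).1
    simpa using this
  refine ⟨⟨R.toNNReal, fun N => ⟨⟨fun k => (measurable_wickField N k).aemeasurable,
    (hN N).trans_lt hRtop⟩, ?_⟩⟩, ⟨hWm, hW.trans_lt hRtop⟩, ?_⟩
  · rw [ENNReal.coe_toNNReal hRtop.ne]
    exact hN N
  · have htail : Tendsto (fun N => (C * ∑' k : Freq 2, ENNReal.ofReal (len k.1 ^ (2 * β)) *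
        tailWt N k) ^ (1 / 2 : ℝ)) atTop (𝓝 0) := by
      have h1 := ENNReal.Tendsto.const_mul (a := C) (tendsto_tsum_tailWt hsum)
        (Or.inr ENNReal.coe_ne_top)
      have h2 := h1.ennrpow_const (1 / 2 : ℝ)
      simpa using h2
    refine tendsto_of_tendsto_of_tendsto_of_le_of_le tendsto_const_nhds htail
      (fun N => zero_le) fun N => ?_
    refine hnorm (fun k => (measurable_wickField N k).aemeasurable.sub (hWm k)) fun k => ?_
    obtain ⟨ns, hns, hlim⟩ := hWlim k
    exact lintegral_enorm_sub_limit_le (fun N => measurable_wickField N k)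
      (measurable_wickField N k) hns hlim fun N' hN' => (hC k N').2 N hN'

end DimensionTwo

end WickNLS

end

theorem proposition3p1 :
    -- d = 1: the series defining `B` converges almost surely, and `B ∈ L^p(μ₂; H^β)`
    ((∀ᵐ φ ∂WickNLS.mu 1 2, ∀ k, Summable (WickNLS.cubicTerm φ k)) ∧
      ∀ β p : ℝ, β < 0 → 1 ≤ p →
        WickNLS.MemLpSobolev (WickNLS.mu 1 2) β p WickNLS.cubicField) ∧
    -- d = 2: uniform bounds and convergence to one limit for all `β` and `p`
    ∃ W : WickNLS.Field 2 → WickNLS.Field 2, ∀ β p : ℝ, β < 0 → 1 ≤ p →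
      (∃ C : ℝ≥0, ∀ N : ℕ,
        WickNLS.MemLpSobolev (WickNLS.mu 2 2) β p (WickNLS.wickField 2 N) ∧
        WickNLS.lpSobolevNorm (WickNLS.mu 2 2) β p (WickNLS.wickField 2 N) ≤ C) ∧
      WickNLS.MemLpSobolev (WickNLS.mu 2 2) β p W ∧
      Tendsto (fun N : ℕ => WickNLS.lpSobolevNorm (WickNLS.mu 2 2) β p
        (fun φ k => WickNLS.wickField 2 N φ k - W φ k)) atTop (𝓝 0) := by
  exact ⟨⟨WickNLS.ae_summable_cubicTerm, fun _ _ hβ hp =>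
    WickNLS.memLpSobolev_cubicField hβ hp⟩, WickNLS.wick_limit_dimension_two⟩
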